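/- **Theorem 2.1.** Let $\omega, V, W:\mathbb R^d\to\mathbb R$ be Borel functions. Let $\omega(-i\nabla)$ denote the Fourier multiplier in $L^2(\mathbb R^d)$ (complex-valued functions) with symbol $\omega$ on its natural domain; $V$ and $W$ also denote the multiplication operators by these functions on their maximal domains. Put $V_a(x)=V(ax)$. Assume: (A.1) There is $c>0$ such that for almost every $\xi\in\mathbb R^d$: $\omega(\xi)\ge 0$; the function $a\mapsto\omega(a\xi)$ is non-decreasing on $(0,1)$ and locally absolutely continuous on $(0,1]$; $\omega$ is differentiable at $\xi$, and $\xi\cdot\nabla\omega(\xi)\le c\,\omega(\xi)$. (A.2) The function $b(a)=\operatorname{ess\,sup}_{\xi\in\mathbb R^d}\frac{\omega(a\xi)}{\omega(\xi)}$ (with $0/0:=0$) is finite on $[\tfrac12,1)$ and differentiable on $(1-\varepsilon,1)$ for some $\varepsilon>0$, and $\ell=\lim_{a\uparrow1}b'(a)$ exists in $(0,\infty)$. (A.3) $V$ is relatively bounded with respect to $\omega(-i\nabla)$ with relative bound less than $1$. (A.4) $\operatorname{Dom}(W)\supset\operatorname{Dom}(\omega(-i\nabla))$, and for every $\psi\in\operatorname{Dom}(\omega(-i\nabla))$,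 $\frac{1}{1-a}(V-V_a)\psi\to W\psi$ weakly in $L^2(\mathbb R^d)$ as $a\uparrow1$. Let $q=1/\ell$ and suppose that $\langle\psi,(V+qW)\psi\rangle<0$ for all $\psi\in\operatorname{Dom}(\omega(-i\nabla))\setminus\{0\}$. Then $H=\omega(-i\nabla)+V$ (operator sum, with domain $\operatorname{Dom}(\omega(-i\nabla))$) has no eigenvalue in $(0,\infty)$. If moreover $V$ is relatively compact with respect to $\omega(-i\nabla)$, then the essential spectrum of $H$ is $[0,\infty)$ and $H$ has no embedded eigenvalue above zero, i.e. no eigenvalue $E>0$ lying in the essential spectrum. Here the essential spectrum of $H$ is the set of $z\in\mathbb C$ for which $H-z$ is not a Fredholm operator. -/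

import Mathlib

open MeasureTheory Filter Topology Set
open scoped FourierTransform

namespace NonlocalSchrodinger

/-- The configuration (or momentum) space `ℝ^d` with its Euclidean norm. -/
abbrev Space (d : ℕ) : Type := EuclideanSpace ℝ (Fin d)

/-- The complex Hilbert space `L²(ℝ^d)` with respect to Lebesgue measure. -/
abbrev L2 (d : ℕ) : Type := Lp (α := Space d) ℂ 2 volume

noncomputable section

/-- The maximal domain `{ψ ∈ L² : f ψ ∈ L²}` of multiplication by `f`. -/
def mulDomain {d : ℕ} (f : Space d → ℝ) : Submodule ℂ (L2 d) where
  carrier := {ψ | MemLp (fun x => (f x : ℂ) * ψ x) 2 volume}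
  add_mem' := by
    intro φ ψ hφ hψ
    simp only [mem_ofPred_eq] at hφ hψ ⊢
    refine (memLp_congr_ae ?_).1 (hφ.add hψ)
    filter_upwards [Lp.coeFn_add φ ψ] with x hx
    rw [hx, Pi.add_apply, Pi.add_apply, mul_add]
  zero_mem' := by
    simp only [mem_ofPred_eq]
    have h0 : MemLp (fun _ : Space d => (0 : ℂ)) 2 volume := MemLp.zero'
    refine (memLp_congr_ae ?_).1 h0
    filter_upwards [Lp.coeFn_zero ℂ 2 (volume : Measure (Space d))] with x hx
    rw [hx, Pi.zero_apply, mul_zero]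
  smul_mem' := by
    intro c ψ hψ
    simp only [mem_ofPred_eq] at hψ ⊢
    refine (memLp_congr_ae ?_).1 (hψ.const_mul c)
    filter_upwards [Lp.coeFn_smul c ψ] with x hx
    rw [hx, Pi.smul_apply, smul_eq_mul, mul_left_comm]

theorem memLp_of_mem_mulDomain {d : ℕ} {f : Space d → ℝ} {ψ : L2 d} (h : ψ ∈ mulDomain f) :
    MemLp (fun x => (f x : ℂ) * ψ x) 2 volume := h

/-- The multiplication operator `ψ ↦ f ψ` in `L²(ℝ^d)` on its maximal domain. -/
def mulOp {d : ℕ} (f : Space d → ℝ) : L2 d →ₗ.[ℂ] L2 d where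
  domain := mulDomain f
  toFun :=
    { toFun := fun ψ => (memLp_of_mem_mulDomain ψ.2).toLp (fun x => (f x : ℂ) * (ψ : L2 d) x)
      map_add' := by
        intro φ ψ
        rw [← MemLp.toLp_add]
        refine MemLp.toLp_congr _ _ ?_
        filter_upwards [Lp.coeFn_add (φ : L2 d) (ψ : L2 d)] with x hx
        rw [Submodule.coe_add, hx, Pi.add_apply, Pi.add_apply, mul_add]
      map_smul' := by
        intro c ψ
        rw [RingHom.id_apply, ← MemLp.toLp_const_smul]
        refine MemLp.toLp_congr _ _ ?_
        filter_upwards [Lp.coeFn_smul c (ψ : L2 d)] with x hx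
        rw [Submodule.coe_smul, hx, Pi.smul_apply, Pi.smul_apply, smul_eq_mul, smul_eq_mul,
          mul_left_comm] }

/-- The Fourier multiplier `ω(-i∇) = 𝓕⁻¹ M 𝓕` on its natural domain. Mathlib's unitary Fourier
transform has the kernel `exp (-2πi x·ξ)`, under which `-i∇` becomes multiplication by `2πξ`;
so `M` is the maximal operator of multiplication by `ξ ↦ ω (2πξ)`. -/
def kinetic {d : ℕ} (ω : Space d → ℝ) : L2 d →ₗ.[ℂ] L2 d :=
  let F : L2 d ≃ₗᵢ[ℂ] L2 d := Lp.fourierTransformₗᵢ (Space d) ℂ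
  let M : L2 d →ₗ.[ℂ] L2 d := mulOp (fun ξ => ω ((2 * Real.pi) • ξ))
  { domain := M.domain.comap F.toLinearEquiv.toLinearMap
    toFun := F.symm.toLinearEquiv.toLinearMap ∘ₗ M.toFun ∘ₗ
      (F.toLinearEquiv.toLinearMap.restrict (fun _ h => h)) }

/-- `H = ω(-i∇) + V`, the operator sum, with domain `Dom (ω(-i∇)) ∩ Dom V`. -/
def hamiltonian {d : ℕ} (ω V : Space d → ℝ) : L2 d →ₗ.[ℂ] L2 d :=
  kinetic ω + mulOp V

/-- `z` is an eigenvalue of the (unbounded) operator `T`. -/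
def IsEigenvalue {d : ℕ} (T : L2 d →ₗ.[ℂ] L2 d) (z : ℂ) : Prop :=
  ∃ ψ : T.domain, (ψ : L2 d) ≠ 0 ∧ T ψ = z • (ψ : L2 d)

/-- `T - z` as a linear map on the domain of `T`. -/
def subScalar {d : ℕ} (T : L2 d →ₗ.[ℂ] L2 d) (z : ℂ) : T.domain →ₗ[ℂ] L2 d :=
  T.toFun - z • T.domain.subtype

/-- The essential spectrum of `T`: the complex numbers `z` for which `T - z` is not a Fredholm
operator, that is, fails to have a finite-dimensional kernel and a closed range of finite
codimension. -/
def essSpectrum {d : ℕ} (T : L2 d →ₗ.[ℂ] L2 d) : Set ℂ :=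
  {z | ¬ (FiniteDimensional ℂ (subScalar T z).ker ∧
      IsClosed ((subScalar T z).range : Set (L2 d)) ∧
      FiniteDimensional ℂ (L2 d ⧸ (subScalar T z).range))}

/-- `B` is relatively bounded with respect to `A`, with relative bound less than `1`. -/
def RelBoundedLTOne {d : ℕ} (B A : L2 d →ₗ.[ℂ] L2 d) : Prop :=
  ∃ h : A.domain ≤ B.domain, ∃ r C : ℝ, 0 ≤ r ∧ r < 1 ∧
    ∀ ψ : A.domain, ‖B (Submodule.inclusion h ψ)‖ ≤ r * ‖A ψ‖ + C * ‖(ψ : L2 d)‖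

/-- `B` is relatively compact with respect to `A`: if `u n` and `A (u n)` are bounded sequences,
then `B (u n)` has a convergent subsequence. -/
def RelCompact {d : ℕ} (B A : L2 d →ₗ.[ℂ] L2 d) : Prop :=
  ∃ h : A.domain ≤ B.domain, ∀ u : ℕ → A.domain,
    (∃ R : ℝ, ∀ n, ‖(u n : L2 d)‖ ≤ R ∧ ‖A (u n)‖ ≤ R) →
    ∃ (s : ℕ → ℕ) (φ : L2 d), StrictMono s ∧
      Tendsto (fun n => B (Submodule.inclusion h (u (s n)))) atTop (𝓝 φ)

/-- For almost every `ξ`: `ω ξ ≥ 0`; `a ↦ ω (a ξ)` is nondecreasing on `(0,1)` and locally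
absolutely continuous on `(0,1]`; `ω` is differentiable at `ξ` and `ξ · ∇ω(ξ) ≤ c ω(ξ)`, with a
constant `c > 0` independent of `ξ`. -/
def KineticRegular {d : ℕ} (ω : Space d → ℝ) : Prop :=
  ∃ c : ℝ, 0 < c ∧ ∀ᵐ ξ : Space d ∂volume,
    0 ≤ ω ξ ∧
    MonotoneOn (fun a : ℝ => ω (a • ξ)) (Ioo 0 1) ∧
    (∀ r ∈ Ioo (0 : ℝ) 1, AbsolutelyContinuousOnInterval (fun a : ℝ => ω (a • ξ)) r 1) ∧
    DifferentiableAt ℝ ω ξ ∧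
    fderiv ℝ ω ξ ξ ≤ c * ω ξ

/-- `b(a)`, the (essential) supremum over `ξ` of `ω(aξ) / ω(ξ)`. The quotient `0 / 0` counts
as `0`. -/
def scalingSup {d : ℕ} (ω : Space d → ℝ) (a : ℝ) : ℝ :=
  essSup (fun ξ => ω (a • ξ) / ω ξ) volume

/-- `b` is well defined, i.e. finite, on `[1/2,1)`, differentiable to the left of `a = 1`, and
`b'(a)` converges to the positive number `ℓ` as `a ↑ 1`. -/
def ScalingDerivLimit {d : ℕ} (ω : Space d → ℝ) (ℓ : ℝ) : Prop :=
  (∀ a ∈ Ico (1 / 2 : ℝ) 1, ∃ K : ℝ, ∀ᵐ ξ : Space d ∂volume, ω (a • ξ) / ω ξ ≤ K) ∧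
  (∀ᶠ a in 𝓝[<] (1 : ℝ), DifferentiableAt ℝ (scalingSup ω) a) ∧
  Tendsto (deriv (scalingSup ω)) (𝓝[<] 1) (𝓝 ℓ) ∧
  0 < ℓ

/-- `Dom W ⊇ Dom (ω(-i∇))`, and `(V - V_a) ψ / (1 - a) → W ψ` weakly in `L²` as `a ↑ 1` for every
`ψ ∈ Dom (ω(-i∇))`, where `V_a(x) = V(a x)`. -/
def IsVirialLimit {d : ℕ} (ω V W : Space d → ℝ) : Prop :=
  (kinetic ω).domain ≤ (mulOp W).domain ∧
  ∀ ψ ∈ (kinetic ω).domain,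
    (∀ᶠ a in 𝓝[<] (1 : ℝ),
      MemLp (fun x => (((V x - V (a • x)) / (1 - a) : ℝ) : ℂ) * ψ x) 2 volume) ∧
    ∀ φ : L2 d,
      Tendsto
        (fun a : ℝ => ∫ x, (starRingEnd ℂ) (φ x) *
          ((((V x - V (a • x)) / (1 - a) : ℝ) : ℂ) * ψ x))
        (𝓝[<] 1)
        (𝓝 (∫ x, (starRingEnd ℂ) (φ x) * ((W x : ℂ) * ψ x)))

end

end NonlocalSchrodinger

namespace NonlocalSchrodinger

noncomputable section

/-! ### Dilations on `L²` and their Fourier transforms. -/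

section

variable {d : ℕ}

/-! The absence of positive eigenvalues is a virial argument with finite dilations in place of the
generator. Write T for the kinetic operator and U_a ψ = ψ(a ·). By `inner_dilation_eq`, ⟨U_a u, v⟩ =
⟨û, U_a v̂⟩. If Tψ + Vψ = Eψ, apply this to the pairs (ψ, Tψ) and (Tψ, ψ) and subtract: the terms in
E cancel, and division by 1 - a gives (`inner_symbolQuotient_eq`) ⟨(ω - ω_a)/(1 - a) ψ̂, U_a ψ̂⟩ =
⟨U_a ψ, (V - V_a)/(1 - a) ψ⟩. As a ↑ 1 the right side tends to ⟨ψ, Wψ⟩, being a pairing of a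
strongly and a weakly convergent family. On the left the quotient is dominated by a multiple of ω
(`KineticRegular.exists_scaling_bound`), so U_a ψ̂ may be replaced by ψ̂; and ω_a ≤ b(a) ω bounds
the resulting form below by (1 - b(a))/(1 - a) ⟨ψ, Tψ⟩, which tends to ℓ ⟨ψ, Tψ⟩ by L'Hôpital. Hence
ℓ(E‖ψ‖² - ⟨ψ, Vψ⟩) ≤ ⟨ψ, Wψ⟩ (`virial_le`), that is, E‖ψ‖² ≤ ⟨ψ, (V + qW)ψ⟩ < 0, which is impossible
for E > 0.

For the essential spectrum, when z lies off [0,∞) one has H - z = (1 + K)(T - z) with T - z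
bijective and K = V(T - z)⁻¹ compact, so H - z is Fredholm. For λ ≥ 0 a Weyl sequence is built from
functions whose Fourier transforms live in disjoint windows of values of the symbol shrinking to λ.
These windows have positive measure (`measure_symbol_mem_Ioo_ne_zero`) because b(a) < 1 forces ω to
sweep out all positive values along almost every ray on which it is not zero. -/

theorem ae_comp_smul {p : Space d → Prop} (h : ∀ᵐ x : Space d, p x) {a : ℝ} (ha : a ≠ 0) :
    ∀ᵐ x : Space d, p (a • x) :=
  (Measure.quasiMeasurePreserving_smul (volume : Measure (Space d)) ha).ae h

theorem memLp_comp_smul {f : Space d → ℂ} (hf : MemLp f 2 volume) {a : ℝ} (ha : a ≠ 0) :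
    MemLp (fun x => f (a • x)) 2 volume := by
  have hmap := Measure.map_addHaar_smul (volume : Measure (Space d)) ha
  have h : MemLp f 2 (Measure.map (a • ·) (volume : Measure (Space d))) := by
    rw [hmap]
    exact hf.smul_measure ENNReal.ofReal_ne_top
  exact (memLp_map_measure_iff h.1 (measurable_const_smul a).aemeasurable).1 h

theorem inner_eq_integral (φ ψ : L2 d) :
    inner ℂ φ ψ = ∫ x, (starRingEnd ℂ) (φ x) * ψ x := by
  rw [L2.inner_def]
  simp only [RCLike.inner_apply']

theorem norm_sq_eq_integral (ψ : L2 d) : ‖ψ‖ ^ 2 = ∫ x, ‖ψ x‖ ^ 2 := by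
  have h := inner_self_eq_norm_sq_to_K (𝕜 := ℂ) ψ
  rw [L2.inner_def] at h
  simp only [inner_self_eq_norm_sq_to_K] at h
  have h2 : ((∫ x, ‖ψ x‖ ^ 2 : ℝ) : ℂ) = ((‖ψ‖ ^ 2 : ℝ) : ℂ) := by
    rw [← integral_complex_ofReal]
    push_cast
    exact h
  exact_mod_cast h2.symm

/-- The dilation `ψ ↦ ψ(a ·)` as a linear map, for `a ≠ 0`. -/
def dilationₗ (a : ℝ) (ha : a ≠ 0) : L2 d →ₗ[ℂ] L2 d where
  toFun ψ := (memLp_comp_smul (Lp.memLp ψ) ha).toLp (fun x => ψ (a • x))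
  map_add' φ ψ := by
    rw [← MemLp.toLp_add]
    refine MemLp.toLp_congr _ _ ?_
    filter_upwards [ae_comp_smul (Lp.coeFn_add φ ψ) ha] with x hx
    exact hx
  map_smul' c ψ := by
    rw [RingHom.id_apply, ← MemLp.toLp_const_smul]
    refine MemLp.toLp_congr _ _ ?_
    filter_upwards [ae_comp_smul (Lp.coeFn_smul c ψ) ha] with x hx
    exact hx

theorem norm_sq_dilationₗ (a : ℝ) (ha : a ≠ 0) (ψ : L2 d) :
    ‖dilationₗ a ha ψ‖ ^ 2 = |(a ^ d)⁻¹| * ‖ψ‖ ^ 2 := by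
  rw [norm_sq_eq_integral, norm_sq_eq_integral]
  have h := Measure.integral_comp_smul (volume : Measure (Space d)) (fun x => ‖ψ x‖ ^ 2) a
  rw [finrank_euclideanSpace, Fintype.card_fin, smul_eq_mul] at h
  rw [← h]
  refine integral_congr_ae ?_
  filter_upwards [(memLp_comp_smul (Lp.memLp ψ) ha).coeFn_toLp] with x hx
  exact congrArg (‖·‖ ^ 2) hx

/-- The bounded dilation operator `ψ ↦ ψ(a ·)`; it is `0` when `a = 0`. -/
def dilation (a : ℝ) : L2 d →L[ℂ] L2 d :=
  if ha : a ≠ 0 then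
    (dilationₗ a ha).mkContinuous (Real.sqrt |(a ^ d)⁻¹|) fun ψ => by
      rw [← Real.sqrt_sq (norm_nonneg (dilationₗ a ha ψ)), norm_sq_dilationₗ,
        Real.sqrt_mul (abs_nonneg _), Real.sqrt_sq (norm_nonneg _)]
  else 0

theorem dilation_apply_of_ne {a : ℝ} (ha : a ≠ 0) (ψ : L2 d) :
    dilation a ψ = dilationₗ a ha ψ := by
  simp [dilation, ha]

theorem coeFn_dilation {a : ℝ} (ha : a ≠ 0) (ψ : L2 d) :
    dilation a ψ =ᵐ[volume] fun x => ψ (a • x) := by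
  rw [dilation_apply_of_ne ha]
  exact (memLp_comp_smul (Lp.memLp ψ) ha).coeFn_toLp

/-- A bound uniform in `a` near 1, which lets strong continuity pass from a dense class to all of
`L²`. -/
theorem norm_dilation_le {a : ℝ} (ha : 1 / 2 ≤ a) (ψ : L2 d) :
    ‖dilation a ψ‖ ≤ 2 ^ d * ‖ψ‖ := by
  have ha0 : 0 < a := by linarith
  have h1 : |(a ^ d)⁻¹| ≤ 2 ^ d := by
    rw [abs_of_pos (by positivity), ← inv_pow]
    refine pow_le_pow_left₀ (by positivity) ?_ d
    rw [inv_le_comm₀ ha0 two_pos]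
    linarith
  have h2 : (1 : ℝ) ≤ 2 ^ d := one_le_pow₀ one_le_two
  refine le_of_sq_le_sq ?_ (by positivity)
  rw [dilation_apply_of_ne ha0.ne', norm_sq_dilationₗ, mul_pow]
  gcongr
  nlinarith

theorem dilation_toLp {a : ℝ} (ha : a ≠ 0) {f : Space d → ℂ} (hf : MemLp f 2 volume) :
    dilation a (hf.toLp f) = (memLp_comp_smul hf ha).toLp (fun x => f (a • x)) := by
  refine Lp.ext ?_
  filter_upwards [coeFn_dilation ha (hf.toLp f), ae_comp_smul hf.coeFn_toLp ha,
    (memLp_comp_smul hf ha).coeFn_toLp] with x h1 h2 h3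
  rw [h1, h2, h3]

theorem tendsto_dilation_toLp_of_hasCompactSupport {f : Space d → ℂ} (hf : MemLp f 2 volume)
    (hfc : Continuous f) (hfs : HasCompactSupport f) :
    Tendsto (fun a : ℝ => dilation a (hf.toLp f)) (𝓝[<] 1) (𝓝 (hf.toLp f)) := by
  obtain ⟨C, hC⟩ := hfs.exists_bound_of_continuous hfc
  obtain ⟨R, hR⟩ := hfs.isCompact.isBounded.subset_closedBall (0 : Space d)
  have hzero : ∀ x : Space d, R < ‖x‖ → f x = 0 := by
    intro x hx
    by_contra hne
    have := hR (subset_tsupport f (Function.mem_support.2 hne))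
    rw [mem_closedBall_zero_iff] at this
    linarith
  have hnear : ∀ᶠ a : ℝ in 𝓝[<] 1, 1 / 2 < a ∧ a < 1 := by
    filter_upwards [Ioo_mem_nhdsLT (show (1 / 2 : ℝ) < 1 by norm_num)] with a ha using ha
  rw [tendsto_iff_norm_sub_tendsto_zero]
  have key : Tendsto (fun a : ℝ => ∫ x : Space d, ‖f (a • x) - f x‖ ^ 2) (𝓝[<] 1) (𝓝 0) := by
    have h0 : (0 : ℝ) = ∫ x : Space d, (0 : ℝ) := by simp
    rw [h0]
    -- For a > 1/2, both f and f(a ·) vanish outside the ball of radius 2R, so one integrable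
    -- majorant serves all such `a`.
    refine tendsto_integral_filter_of_dominated_convergence
      ((Metric.closedBall (0 : Space d) (2 * R)).indicator fun _ => (C + C) ^ 2) ?_ ?_ ?_ ?_
    · refine Eventually.of_forall fun a => Continuous.aestronglyMeasurable ?_
      fun_prop
    · filter_upwards [hnear] with a ha
      refine Eventually.of_forall fun x => ?_
      rw [Real.norm_of_nonneg (by positivity)]
      by_cases hx : x ∈ Metric.closedBall (0 : Space d) (2 * R)
      · rw [indicator_of_mem hx]
        gcongr
        exact (norm_sub_le _ _).trans (add_le_add (hC _) (hC _))
      · rw [indicator_of_notMem hx]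
        rw [mem_closedBall_zero_iff, not_le] at hx
        have hx0 := norm_nonneg x
        rw [hzero x (by linarith), hzero (a • x)]
        · simp
        · rw [norm_smul, Real.norm_of_nonneg (by linarith)]
          nlinarith
    · exact (integrable_indicator_iff Metric.isClosed_closedBall.measurableSet).2
        (integrableOn_const (isCompact_closedBall _ _).measure_lt_top.ne)
    · refine Eventually.of_forall fun x => ?_
      have hcont : Continuous fun a : ℝ => ‖f (a • x) - f x‖ ^ 2 := by fun_prop
      have := hcont.tendsto 1
      simp only [one_smul, sub_self, norm_zero] at this
      exact (this.mono_left nhdsWithin_le_nhds).trans_eq (by norm_num)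
  have h2 : Tendsto (fun a : ℝ => Real.sqrt (∫ x : Space d, ‖f (a • x) - f x‖ ^ 2))
      (𝓝[<] 1) (𝓝 0) := by
    simpa [Function.comp_def] using (Real.continuous_sqrt.tendsto 0).comp key
  refine h2.congr' ?_
  filter_upwards [hnear] with a ha
  have ha0 : a ≠ 0 := by linarith
  rw [Real.sqrt_eq_iff_mul_self_eq (by positivity) (norm_nonneg _), ← sq, norm_sq_eq_integral]
  refine integral_congr_ae ?_
  filter_upwards [Lp.coeFn_sub (dilation a (hf.toLp f)) (hf.toLp f), hf.coeFn_toLp,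
    ae_comp_smul hf.coeFn_toLp ha0, coeFn_dilation ha0 (hf.toLp f)] with x h1 h2 h3 h4
  rw [h1, Pi.sub_apply, h2, h4, h3]

/-- Dilations are strongly continuous at `a = 1`. -/
theorem tendsto_dilation (ψ : L2 d) :
    Tendsto (fun a : ℝ => dilation a ψ) (𝓝[<] 1) (𝓝 ψ) := by
  rw [Metric.tendsto_nhds]
  intro ε hε
  set M : ℝ := 2 ^ d with hM
  have hM1 : 1 ≤ M := one_le_pow₀ one_le_two
  set δ : ℝ := ε / (4 * M) with hδ
  have hδ0 : 0 < δ := by positivity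
  obtain ⟨g, hgs, hgn, hgc, hg⟩ := (Lp.memLp ψ).exists_hasCompactSupport_eLpNorm_sub_le
    (by norm_num) (ε := ENNReal.ofReal δ) (by simpa using hδ0)
  have hdist : ‖ψ - hg.toLp g‖ ≤ δ := by
    rw [Lp.norm_def]
    refine ENNReal.toReal_le_of_le_ofReal hδ0.le ?_
    refine le_trans (le_of_eq (eLpNorm_congr_ae ?_)) hgn
    filter_upwards [Lp.coeFn_sub ψ (hg.toLp g), hg.coeFn_toLp] with x h1 h2
    rw [h1, Pi.sub_apply, h2, Pi.sub_apply]
  have hg2 := Metric.tendsto_nhds.1 (tendsto_dilation_toLp_of_hasCompactSupport hg hgc hgs)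
    (ε / 4) (by positivity)
  filter_upwards [hg2, Ioo_mem_nhdsLT (show (1 / 2 : ℝ) < 1 by norm_num)] with a h1 h2
  rw [dist_eq_norm] at h1 ⊢
  have h3 := norm_dilation_le h2.1.le (ψ - hg.toLp g)
  rw [map_sub] at h3
  have h4 : dilation a ψ - ψ = (dilation a ψ - dilation a (hg.toLp g))
      + (dilation a (hg.toLp g) - hg.toLp g) - (ψ - hg.toLp g) := by abel
  have h5 : M * ‖ψ - hg.toLp g‖ ≤ M * δ := by gcongr
  have h6 : M * δ = ε / 4 := by rw [hδ]; field_simp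
  have h7 : δ ≤ M * δ := le_mul_of_one_le_left hδ0.le hM1
  calc ‖dilation a ψ - ψ‖ ≤ ‖dilation a ψ - dilation a (hg.toLp g)‖
      + ‖dilation a (hg.toLp g) - hg.toLp g‖ + ‖ψ - hg.toLp g‖ := by
        rw [h4]
        exact (norm_sub_le _ _).trans (add_le_add_left (norm_add_le _ _) _)
    _ < ε := by linarith

theorem fourier_comp_smul (f : Space d → ℂ) {a : ℝ} (ha : a ≠ 0) (ξ : Space d) :
    𝓕 (fun x => f (a • x)) ξ = |(a ^ d)⁻¹| • 𝓕 f (a⁻¹ • ξ) := by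
  rw [Real.fourier_eq, Real.fourier_eq]
  have h := Measure.integral_comp_smul (volume : Measure (Space d))
    (fun y => Real.fourierChar (-inner ℝ (a⁻¹ • y) ξ) • f y) a
  rw [finrank_euclideanSpace, Fintype.card_fin] at h
  simp only [smul_smul, inv_mul_cancel₀ ha, one_smul] at h
  rw [h]
  simp only [real_inner_smul_left, real_inner_smul_right]

/-- The adjoint of a dilation is the same dilation on the Fourier side. -/
theorem inner_dilation_eq (a : ℝ) (ha : a ≠ 0) (u v : L2 d) :
    inner ℂ (dilation a u) v =
      inner ℂ (Lp.fourierTransformₗᵢ (Space d) ℂ u)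
        (dilation a (Lp.fourierTransformₗᵢ (Space d) ℂ v)) := by
  -- Both sides are continuous in `u` and `v`, so Schwartz functions suffice, where the Fourier
  -- transform is an integral.
  have hdense := SchwartzMap.denseRange_toLpCLM (E := Space d) (F := ℂ) (p := 2)
    (μ := volume) ENNReal.ofNat_ne_top
  refine DenseRange.induction_on₂ (p := fun u v : L2 d => inner ℂ (dilation a u) v =
      inner ℂ (Lp.fourierTransformₗᵢ (Space d) ℂ u)
        (dilation a (Lp.fourierTransformₗᵢ (Space d) ℂ v))) hdense ?_ ?_ u v
  · apply isClosed_eq <;> fun_prop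
  · intro f g
    let e : Space d ≃L[ℝ] Space d := ContinuousLinearEquiv.smulLeft (Units.mk0 a ha)
    let fa : SchwartzMap (Space d) ℂ := SchwartzMap.compCLMOfContinuousLinearEquiv ℂ e f
    have hfa : (fa : Space d → ℂ) = fun x => f (a • x) := rfl
    have hF : ∀ h : SchwartzMap (Space d) ℂ,
        Lp.fourierTransformₗᵢ (Space d) ℂ (h.toLp 2 volume) = (𝓕 h).toLp 2 volume :=
      SchwartzMap.toLp_fourier_eq
    have hd : dilation a (f.toLp 2 volume) = fa.toLp 2 volume := by
      refine Lp.ext ?_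
      filter_upwards [coeFn_dilation ha (f.toLp 2 volume), ae_comp_smul (f.coeFn_toLp 2 volume) ha,
        fa.coeFn_toLp 2 volume] with x h1 h2 h3
      rw [h1, h2, h3, hfa]
    change inner ℂ (dilation a (f.toLp 2 volume)) (g.toLp 2 volume) =
      inner ℂ (Lp.fourierTransformₗᵢ (Space d) ℂ (f.toLp 2 volume))
        (dilation a (Lp.fourierTransformₗᵢ (Space d) ℂ (g.toLp 2 volume)))
    rw [hd, ← (Lp.fourierTransformₗᵢ (Space d) ℂ).inner_map_map, hF, hF, hF,
      inner_eq_integral, inner_eq_integral]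
    have h1 : ∀ ξ : Space d, (𝓕 fa) ξ = |(a ^ d)⁻¹| • (𝓕 f) (a⁻¹ • ξ) := by
      intro ξ
      rw [SchwartzMap.fourier_coe, SchwartzMap.fourier_coe, hfa]
      exact fourier_comp_smul f ha ξ
    have h2 := Measure.integral_comp_smul (volume : Measure (Space d))
      (fun η => (starRingEnd ℂ) ((𝓕 f) (a⁻¹ • η)) * (𝓕 g) η) a
    rw [finrank_euclideanSpace, Fintype.card_fin] at h2
    simp only [smul_smul, inv_mul_cancel₀ ha, one_smul] at h2
    -- The factor |a^d|⁻¹ from the Fourier transform of f(a ·) is exactly the Jacobian of ξ ↦ aξ, so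
    -- none survives.
    calc ∫ x, (starRingEnd ℂ) ((𝓕 fa).toLp 2 volume x) * (𝓕 g).toLp 2 volume x
        = ∫ x, |(a ^ d)⁻¹| • ((starRingEnd ℂ) ((𝓕 f) (a⁻¹ • x)) * (𝓕 g) x) := by
          refine integral_congr_ae ?_
          filter_upwards [(𝓕 fa).coeFn_toLp 2 volume, (𝓕 g).coeFn_toLp 2 volume] with x h3 h4
          rw [h3, h4, h1]
          simp [mul_assoc]
      _ = ∫ x, (starRingEnd ℂ) ((𝓕 f) x) * (𝓕 g) (a • x) := by
          rw [integral_smul, h2]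
      _ = _ := by
          refine integral_congr_ae ?_
          filter_upwards [(𝓕 f).coeFn_toLp 2 volume, ae_comp_smul ((𝓕 g).coeFn_toLp 2 volume) ha,
            coeFn_dilation ha ((𝓕 g).toLp 2 volume)] with x h3 h4 h5
          rw [h3, h5, h4]

end

/-! ### Scaling properties of the symbol. -/

section

variable {d : ℕ} {ω : Space d → ℝ}

/-- Each nonzero dilation preserves null sets; Fubini then exchanges the order of the two
quantifiers. The measurable hull `N` is needed because the exceptional set of `p` need not be
measurable. -/
theorem ae_ae_smul {p : Space d → Prop} (h : ∀ᵐ x : Space d, p x) :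
    ∀ᵐ ξ : Space d, ∀ᵐ s : ℝ, p (s • ξ) := by
  set N := toMeasurable volume {x : Space d | ¬ p x} with hN
  have hNm : MeasurableSet N := measurableSet_toMeasurable _ _
  have hN0 : ∀ᵐ x : Space d, x ∉ N := by
    rw [ae_iff]
    simp only [not_not, ofPred_mem_eq, hN, measure_toMeasurable]
    exact h
  have hs : ∀ᵐ s : ℝ, ∀ᵐ ξ : Space d, s • ξ ∉ N := by
    have h0 : ∀ᵐ s : ℝ, s ≠ 0 := by simp [ae_iff]
    filter_upwards [h0] with s hs using ae_comp_smul hN0 hs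
  have hmeas : MeasurableSet {x : ℝ × Space d | x.1 • x.2 ∉ N} :=
    (measurable_smul hNm).compl
  filter_upwards [(Measure.ae_ae_comm (p := fun (s : ℝ) (ξ : Space d) => s • ξ ∉ N) hmeas).1 hs]
    with ξ hξ
  filter_upwards [hξ] with s hs'
  by_contra hp
  exact hs' (subset_toMeasurable _ _ hp)

/-- Almost every `ξ` satisfies pointwise upper and lower scaling bounds near `a = 1`. -/
theorem KineticRegular.exists_scaling_bound (h : KineticRegular ω) :
    ∃ c : ℝ, 0 < c ∧ ∀ᵐ ξ : Space d, 0 ≤ ω ξ ∧ (∀ a ∈ Ioo (0 : ℝ) 1, ω (a • ξ) ≤ ω ξ) ∧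
      ∀ a ∈ Ico (1 / 2 : ℝ) 1, ω ξ - ω (a • ξ) ≤ c * (1 - a) * ω ξ := by
  obtain ⟨c, hc, hω⟩ := h
  refine ⟨2 * c, by positivity, ?_⟩
  filter_upwards [hω, ae_ae_smul hω] with ξ hξ hray
  obtain ⟨h0, hmono, hac, -, -⟩ := hξ
  set f : ℝ → ℝ := fun a => ω (a • ξ) with hf
  have hf1 : f 1 = ω ξ := by simp [hf]
  -- Monotonicity is assumed only on the open interval; continuity at the endpoint 1 extends the
  -- comparison to ω(ξ).
  have hle : ∀ a ∈ Ioo (0 : ℝ) 1, f a ≤ ω ξ := by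
    intro a ha
    have hcont := (hac (1 / 2) (by norm_num)).continuousOn
    rw [uIcc_of_le (by norm_num)] at hcont
    have htend : Tendsto f (𝓝[<] 1) (𝓝 (f 1)) := by
      refine (hcont 1 (by norm_num)).mono_left ?_
      rw [← nhdsWithin_Ioo_eq_nhdsLT (show (1 / 2 : ℝ) < 1 by norm_num)]
      exact nhdsWithin_mono _ Ioo_subset_Icc_self
    rw [← hf1]
    refine ge_of_tendsto htend ?_
    filter_upwards [Ioo_mem_nhdsLT ha.2] with t ht
    exact hmono ha ⟨ha.1.trans ht.1, ht.2⟩ ht.1.le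
  refine ⟨h0, hle, fun a ha => ?_⟩
  have haca : AbsolutelyContinuousOnInterval f a 1 := hac a ⟨by linarith [ha.1], ha.2⟩
  have hFTC := haca.integral_deriv_eq_sub
  -- Along the ray, s f'(s) = (sξ)·∇ω(sξ) ≤ c ω(sξ) ≤ c ω(ξ), and s ≥ 1/2 turns c into 2c. The
  -- hypotheses at sξ hold for almost every s, which is enough for the fundamental theorem of
  -- calculus.
  have hbound : ∀ᵐ s : ℝ, s ∈ Icc a 1 → deriv f s ≤ 2 * c * ω ξ := by
    have hne : ∀ᵐ s : ℝ, s ≠ 1 := by simp [ae_iff]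
    filter_upwards [hray, hne] with s hs hs1 hsa
    obtain ⟨hs0, -, -, hdiff, hder⟩ := hs
    have hspos : 1 / 2 ≤ s := ha.1.trans hsa.1
    have hslt : s < 1 := lt_of_le_of_ne hsa.2 hs1
    have hd : HasDerivAt f (fderiv ℝ ω (s • ξ) ξ) s := by
      have h1 : HasDerivAt (fun t : ℝ => t • ξ) ξ s := by
        simpa using (hasDerivAt_id s).smul_const ξ
      exact hdiff.hasFDerivAt.comp_hasDerivAt s h1
    rw [hd.deriv]
    rw [map_smul, smul_eq_mul] at hder
    have h2 := hle s ⟨by linarith, hslt⟩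
    change ω (s • ξ) ≤ ω ξ at h2
    have h3 : s * (fderiv ℝ ω (s • ξ) ξ) ≤ c * ω ξ :=
      hder.trans (mul_le_mul_of_nonneg_left h2 hc.le)
    by_contra hcon
    push Not at hcon
    have h4 : 0 ≤ c * ω ξ := by positivity
    nlinarith
  have hint : ∫ s in a..1, deriv f s ≤ ∫ _s in a..1, 2 * c * ω ξ := by
    refine intervalIntegral.integral_mono_ae_restrict ha.2.le haca.intervalIntegrable_deriv
      intervalIntegrable_const ?_
    exact (ae_restrict_iff' measurableSet_Icc).2 hbound
  rw [hFTC, hf1, intervalIntegral.integral_const, smul_eq_mul] at hint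
  change ω ξ - f a ≤ _
  linarith

/-- A real-valued `essSup` can be bounded above by an almost everywhere bound only if the function
is also controlled from below. -/
theorem isBoundedUnder_ge_scaling (hreg : KineticRegular ω) {a : ℝ} (ha : a ≠ 0) :
    IsBoundedUnder (· ≥ ·) (ae (volume : Measure (Space d))) fun ξ => ω (a • ξ) / ω ξ := by
  obtain ⟨c, -, hc⟩ := hreg.exists_scaling_bound
  refine ⟨0, ?_⟩
  rw [eventually_map]
  filter_upwards [hc, ae_comp_smul hc ha] with ξ h1 h2
  exact div_nonneg h2.1 h1.1

theorem ae_le_scalingSup_mul (hreg : KineticRegular ω) {ℓ : ℝ} (h : ScalingDerivLimit ω ℓ)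
    {a : ℝ} (ha : a ∈ Ico (1 / 2 : ℝ) 1) :
    ∀ᵐ ξ : Space d, ω (a • ξ) ≤ scalingSup ω a * ω ξ := by
  obtain ⟨c, -, hc⟩ := hreg.exists_scaling_bound
  have hb : IsBoundedUnder (· ≤ ·) (ae (volume : Measure (Space d)))
      fun ξ => ω (a • ξ) / ω ξ := by
    obtain ⟨K, hK⟩ := h.1 a ha
    exact ⟨K, hK⟩
  filter_upwards [ae_le_essSup hb, hc] with ξ h1 h2
  -- Where ω(ξ) = 0 the quotient carries no information, but monotonicity gives ω(aξ) ≤ 0.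
  rcases h2.1.eq_or_lt with h0 | h0
  · have := h2.2.1 a ⟨by linarith [ha.1], ha.2⟩
    rw [← h0] at this ⊢
    simpa using this
  · rwa [← div_le_iff₀ h0]

theorem scalingSup_le_one (hreg : KineticRegular ω) {a : ℝ} (ha : a ∈ Ioo (0 : ℝ) 1) :
    scalingSup ω a ≤ 1 := by
  obtain ⟨c, -, hc⟩ := hreg.exists_scaling_bound
  refine limsup_le_of_le (isBoundedUnder_ge_scaling hreg ha.1.ne').isCoboundedUnder_le ?_
  filter_upwards [hc] with ξ h2
  exact div_le_one_of_le₀ (h2.2.1 a ha) h2.1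

/-- For a symbol vanishing almost everywhere the convention 0/0 = 0 makes b identically zero near 1,
so b' would tend to 0 and not to ℓ > 0. -/
theorem ScalingDerivLimit.not_ae_eq_zero {ℓ : ℝ} (h : ScalingDerivLimit ω ℓ) :
    ¬ ∀ᵐ ξ : Space d, ω ξ = 0 := by
  intro h0
  have hb : ∀ a : ℝ, a ≠ 0 → scalingSup ω a = 0 := by
    intro a ha
    have h1 : (fun ξ => ω (a • ξ) / ω ξ) =ᵐ[volume] fun _ : Space d => (0 : ℝ) := by
      filter_upwards [h0] with ξ h1
      simp [h1]
    rw [scalingSup, essSup_congr_ae h1]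
    exact essSup_const' _
  have hd : ∀ᶠ a in 𝓝[<] (1 : ℝ), deriv (scalingSup ω) a = 0 := by
    filter_upwards [Ioo_mem_nhdsLT (show (0 : ℝ) < 1 by norm_num)] with a ha
    have h1 : scalingSup ω =ᶠ[𝓝 a] fun _ => (0 : ℝ) := by
      filter_upwards [Ioo_mem_nhds ha.1 ha.2] with t ht using hb t ht.1.ne'
    rw [h1.deriv_eq, deriv_const]
  have h2 : Tendsto (deriv (scalingSup ω)) (𝓝[<] 1) (𝓝 0) :=
    tendsto_const_nhds.congr' (hd.mono fun a ha => ha.symm)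
  exact h.2.2.2.ne (tendsto_nhds_unique h2 h.2.2.1)

/-- Squeeze 1 - c(1 - a) ≤ b(a) ≤ 1: a smaller b(a) would contradict the pointwise lower bound on
ω(aξ) wherever ω(ξ) > 0. -/
theorem tendsto_scalingSup (hreg : KineticRegular ω) {ℓ : ℝ} (h : ScalingDerivLimit ω ℓ) :
    Tendsto (scalingSup ω) (𝓝[<] 1) (𝓝 1) := by
  obtain ⟨c, -, hc⟩ := hreg.exists_scaling_bound
  have hlim : Tendsto (fun a : ℝ => 1 - c * (1 - a)) (𝓝[<] 1) (𝓝 1) := by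
    have h1 : Continuous fun a : ℝ => 1 - c * (1 - a) := by fun_prop
    exact ((h1.tendsto 1).mono_left nhdsWithin_le_nhds).trans_eq (by norm_num)
  refine tendsto_of_tendsto_of_tendsto_of_le_of_le' hlim tendsto_const_nhds ?_ ?_
  · filter_upwards [Ioo_mem_nhdsLT (show (1 / 2 : ℝ) < 1 by norm_num)] with a ha
    by_contra hcon
    push Not at hcon
    refine h.not_ae_eq_zero ?_
    filter_upwards [hc, ae_le_scalingSup_mul hreg h ⟨ha.1.le, ha.2⟩] with ξ h1 h2
    have h3 := h1.2.2 a ⟨ha.1.le, ha.2⟩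
    refine le_antisymm ?_ h1.1
    by_contra h4
    push Not at h4
    nlinarith
  · filter_upwards [Ioo_mem_nhdsLT (show (0 : ℝ) < 1 by norm_num)] with a ha
      using scalingSup_le_one hreg ha

theorem tendsto_one_sub_scalingSup_div (hreg : KineticRegular ω) {ℓ : ℝ}
    (h : ScalingDerivLimit ω ℓ) :
    Tendsto (fun a => (1 - scalingSup ω a) / (1 - a)) (𝓝[<] 1) (𝓝 ℓ) := by
  have hg : ∀ a : ℝ, deriv (fun a : ℝ => 1 - a) a = -1 := by
    intro a
    simp
  refine deriv.lhopital_zero_nhdsLT ?_ ?_ ?_ ?_ ?_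
  · filter_upwards [h.2.1] with a ha using ha.const_sub 1
  · exact Eventually.of_forall fun a => by rw [hg]; norm_num
  · simpa using (tendsto_scalingSup hreg h).const_sub 1
  · have h1 : Continuous fun a : ℝ => 1 - a := by fun_prop
    exact ((h1.tendsto 1).mono_left nhdsWithin_le_nhds).trans_eq (by norm_num)
  · refine h.2.2.1.congr fun a => ?_
    rw [hg, deriv_const_sub, div_neg, div_one, neg_neg]

/-- The essential range of the symbol contains every positive level. -/
theorem measure_symbol_mem_Ioo_ne_zero (hreg : KineticRegular ω) {ℓ : ℝ}
    (h : ScalingDerivLimit ω ℓ) {α β : ℝ} (hα : 0 < α) (hαβ : α < β) :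
    volume {ξ : Space d | ω ξ ∈ Ioo α β} ≠ 0 := by
  intro hnull
  have hN : ∀ᵐ ξ : Space d, ω ξ ∉ Ioo α β := by
    rw [ae_iff]
    simpa using hnull
  -- Near 1 the quotient (1 - b(a))/(1 - a) is close to ℓ > 0, hence b(a) < 1; one such `a` makes ω
  -- contract geometrically under ξ ↦ aξ.
  obtain ⟨a, ha, hb0, hb1⟩ : ∃ a ∈ Ioo (1 / 2 : ℝ) 1,
      0 < scalingSup ω a ∧ scalingSup ω a < 1 := by
    have e1 := (tendsto_scalingSup hreg h).eventually (lt_mem_nhds one_pos)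
    have e2 := (tendsto_one_sub_scalingSup_div hreg h).eventually (lt_mem_nhds h.2.2.2)
    obtain ⟨a, ha, h1, h2⟩ :=
      (Eventually.and (Ioo_mem_nhdsLT (show (1 / 2 : ℝ) < 1 by norm_num)) (e1.and e2)).exists
    refine ⟨a, ha, h1, ?_⟩
    have h3 : 0 < 1 - a := by linarith [ha.2]
    have := (div_pos_iff_of_pos_right h3).1 h2
    linarith
  set b := scalingSup ω a with hb
  have ha0 : 0 < a := by linarith [ha.1]
  obtain ⟨c, -, hω⟩ := id hreg
  have hstep : ∀ᵐ ξ : Space d, ∀ k : ℤ, ω (a • a ^ k • ξ) ≤ b * ω (a ^ k • ξ) := by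
    rw [ae_all_iff]
    intro k
    exact ae_comp_smul (ae_le_scalingSup_mul hreg h ⟨ha.1.le, ha.2⟩) (zpow_ne_zero k ha0.ne')
  have hac : ∀ᵐ ξ : Space d, ∀ k : ℤ, ∀ r ∈ Ioo (0 : ℝ) 1,
      AbsolutelyContinuousOnInterval (fun t : ℝ => ω (t • a ^ k • ξ)) r 1 := by
    rw [ae_all_iff]
    intro k
    filter_upwards [ae_comp_smul hω (zpow_ne_zero k ha0.ne')] with ξ h1 using h1.2.2.1
  have hgood := (ae_ae_smul hN).and (hstep.and (hac.and hω))
  -- One ray on which ω(ξ) ≠ 0 and all the almost-sure properties hold, at every integer dilate a^k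
  -- ξ simultaneously.
  obtain ⟨ξ, hξ0, hray, hstepξ, hacξ, hξnn, -⟩ :=
    (Frequently.and_eventually (not_eventually.1 h.not_ae_eq_zero) hgood).exists
  have hpos : 0 < ω ξ := lt_of_le_of_ne hξnn (Ne.symm hξ0)
  set f : ℝ → ℝ := fun s => ω (s • ξ) with hf
  have hdown : ∀ n : ℕ, f (a ^ n) ≤ b ^ n * ω ξ := by
    intro n
    induction n with
    | zero => simp [hf]
    | succ n ih =>
      have h1 := hstepξ n
      rw [smul_smul, zpow_natCast, ← pow_succ'] at h1
      calc f (a ^ (n + 1)) ≤ b * f (a ^ n) := h1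
        _ ≤ b * (b ^ n * ω ξ) := by gcongr
        _ = b ^ (n + 1) * ω ξ := by ring
  have hup : ∀ n : ℕ, ω ξ ≤ b ^ n * f (a ^ (-(n : ℤ))) := by
    intro n
    induction n with
    | zero => simp [hf]
    | succ n ih =>
      have h1 := hstepξ (-((n + 1 : ℕ) : ℤ))
      rw [smul_smul] at h1
      have h2 : a * a ^ (-((n + 1 : ℕ) : ℤ)) = a ^ (-(n : ℤ)) := by
        rw [← zpow_one_add₀ ha0.ne']
        congr 1
        push_cast
        ring
      rw [h2] at h1
      calc ω ξ ≤ b ^ n * f (a ^ (-(n : ℤ))) := ih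
        _ ≤ b ^ n * (b * f (a ^ (-((n + 1 : ℕ) : ℤ)))) := by gcongr
        _ = _ := by ring
  have hbn : Tendsto (fun n : ℕ => b ^ n) atTop (𝓝 0) :=
    tendsto_pow_atTop_nhds_zero_of_lt_one hb0.le hb1
  obtain ⟨m, hm1, hm⟩ : ∃ m : ℕ, 1 ≤ m ∧ f (a ^ m) ≤ α := by
    have h1 : Tendsto (fun n : ℕ => b ^ n * ω ξ) atTop (𝓝 0) := by
      simpa using hbn.mul_const (ω ξ)
    obtain ⟨m, h2, h3⟩ := ((h1.eventually (gt_mem_nhds hα)).and (eventually_ge_atTop 1)).exists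
    exact ⟨m, h3, (hdown m).trans h2.le⟩
  obtain ⟨n, hn⟩ : ∃ n : ℕ, β ≤ f (a ^ (-(n : ℤ))) := by
    have h1 : Tendsto (fun n : ℕ => b ^ n * β) atTop (𝓝 0) := by
      simpa using hbn.mul_const β
    obtain ⟨n, h2⟩ := (h1.eventually (gt_mem_nhds hpos)).exists
    refine ⟨n, ?_⟩
    have h3 := h2.le.trans (hup n)
    exact le_of_mul_le_mul_left h3 (by positivity)
  set A : ℝ := a ^ (-(n : ℤ)) with hA
  have hA1 : 1 ≤ A := by
    rw [hA, zpow_neg, zpow_natCast]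
    exact (one_le_inv₀ (by positivity)).2 (pow_le_one₀ ha0.le ha.2.le)
  have hA0 : 0 < A := by linarith
  have hsm1 : a ^ m < 1 := pow_lt_one₀ ha0.le ha.2 (by omega)
  have hsm0 : 0 < a ^ m := by positivity
  have hr : a ^ m / A ∈ Ioo (0 : ℝ) 1 := by
    refine ⟨by positivity, ?_⟩
    rw [div_lt_one hA0]
    linarith
  -- Absolute continuity is available only for parameters up to 1, so it is applied at the far point
  -- Aξ and rescaled.
  have hcont : ContinuousOn f (Icc (a ^ m) A) := by
    have h1 := (hacξ (-(n : ℤ)) _ hr).continuousOn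
    rw [uIcc_of_le hr.2.le] at h1
    have h2 : f = (fun t : ℝ => ω (t • a ^ (-(n : ℤ)) • ξ)) ∘ fun s => s / A := by
      funext s
      simp only [hf, Function.comp_apply, smul_smul]
      rw [← hA, div_mul_cancel₀ _ hA0.ne']
    rw [h2]
    refine h1.comp (by fun_prop) fun s hs => ?_
    exact ⟨div_le_div_of_nonneg_right hs.1 hA0.le, div_le_one_of_le₀ hs.2 hA0.le⟩
  obtain ⟨s, hs, hfs⟩ := intermediate_value_Icc (by linarith : a ^ m ≤ A) hcont
    (show (α + β) / 2 ∈ Icc (f (a ^ m)) (f A) from ⟨by linarith, by linarith⟩)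
  have hsm : a ^ m < s := lt_of_le_of_ne hs.1 (by rintro rfl; linarith)
  have hsA : s < A := lt_of_le_of_ne hs.2 (by rintro rfl; linarith)
  have hcs : ContinuousAt f s := hcont.continuousAt (Icc_mem_nhds hsm hsA)
  have hev : ∀ᶠ t in 𝓝 s, f t ∈ Ioo α β :=
    hcs.eventually (Ioo_mem_nhds (by linarith) (by linarith))
  -- An open set of parameters has positive measure, whereas a null window would meet this ray in a
  -- null set.
  have hposm : 0 < volume {t : ℝ | f t ∈ Ioo α β} := Measure.measure_pos_of_mem_nhds volume hev
  refine hposm.ne' ?_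
  rw [ae_iff] at hray
  simpa [hf] using hray

end

/-! ### The virial identity and the absence of positive eigenvalues. -/

section

variable {d : ℕ} {ω V W : Space d → ℝ}

/-- The symbol of the kinetic energy in the normalisation of Mathlib's Fourier transform. -/
def symbol (ω : Space d → ℝ) (ξ : Space d) : ℝ := ω ((2 * Real.pi) • ξ)

theorem ae_symbol {p : Space d → Prop} (h : ∀ᵐ ξ : Space d, p ξ) :
    ∀ᵐ ξ : Space d, p ((2 * Real.pi) • ξ) :=
  ae_comp_smul h (by positivity)

theorem symbol_smul (ω : Space d → ℝ) (a : ℝ) (ξ : Space d) :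
    symbol ω (a • ξ) = ω (a • (2 * Real.pi) • ξ) := by
  rw [symbol, smul_comm]

theorem measurable_symbol (hω : Measurable ω) : Measurable (symbol ω) :=
  hω.comp (measurable_const_smul _)

theorem coeFn_mulOp (f : Space d → ℝ) (ψ : (mulOp f).domain) :
    mulOp f ψ =ᵐ[volume] fun x => (f x : ℂ) * (ψ : L2 d) x :=
  (memLp_of_mem_mulDomain ψ.2).coeFn_toLp

/-- The Fourier transform on `L²`. -/
abbrev fourierL2 (d : ℕ) : L2 d ≃ₗᵢ[ℂ] L2 d := Lp.fourierTransformₗᵢ (Space d) ℂ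

theorem mem_kinetic_domain {ψ : L2 d} :
    ψ ∈ (kinetic ω).domain ↔ fourierL2 d ψ ∈ (mulOp (symbol ω)).domain := Iff.rfl

theorem fourier_kinetic (ψ : (kinetic ω).domain) :
    fourierL2 d (kinetic ω ψ) = mulOp (symbol ω) ⟨fourierL2 d ψ, mem_kinetic_domain.1 ψ.2⟩ :=
  (fourierL2 d).apply_symm_apply _

/-- Weakly convergent sequences are bounded by Banach–Steinhaus, so the error from the strong factor
tends to zero. -/
theorem tendsto_inner_of_weak_of_strong {H : Type*} [NormedAddCommGroup H]
    [InnerProductSpace ℂ H] [CompleteSpace H] {x y : ℕ → H} {x₀ y₀ : H}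
    (hx : ∀ φ, Tendsto (fun n => inner ℂ φ (x n)) atTop (𝓝 (inner ℂ φ x₀)))
    (hy : Tendsto y atTop (𝓝 y₀)) :
    Tendsto (fun n => inner ℂ (y n) (x n)) atTop (𝓝 (inner ℂ y₀ x₀)) := by
  obtain ⟨C, hC⟩ : ∃ C, ∀ n, ‖innerSL ℂ (x n)‖ ≤ C := by
    refine banach_steinhaus fun φ => ?_
    obtain ⟨C, hC⟩ := (hx φ).norm.bddAbove_range
    refine ⟨C, fun n => ?_⟩
    rw [innerSL_apply_apply, norm_inner_symm]
    exact hC ⟨n, rfl⟩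
  have h1 : Tendsto (fun n => inner ℂ (y n - y₀) (x n)) atTop (𝓝 0) := by
    have h2 : Tendsto (fun n => ‖y n - y₀‖ * C) atTop (𝓝 0) := by
      simpa using (tendsto_iff_norm_sub_tendsto_zero.1 hy).mul_const C
    refine squeeze_zero_norm (fun n => (norm_inner_le_norm _ _).trans ?_) h2
    have := hC n
    rw [innerSL_apply_norm] at this
    gcongr
  have h2 := h1.add (hx y₀)
  simpa only [inner_sub_left, sub_add_cancel, zero_add] using h2

theorem inner_sub_inner_eq (c : ℂ) {u v w z x y : L2 d}
    (h : ∀ᵐ t, (starRingEnd ℂ) (u t) * v t - (starRingEnd ℂ) (w t) * z t =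
      c * ((starRingEnd ℂ) (x t) * y t)) :
    inner ℂ u v - inner ℂ w z = c * inner ℂ x y := by
  have hint : ∀ p q : L2 d, Integrable (fun t => (starRingEnd ℂ) (p t) * q t) := fun p q => by
    simpa only [RCLike.inner_apply'] using L2.integrable_inner (𝕜 := ℂ) p q
  rw [inner_eq_integral, inner_eq_integral, inner_eq_integral, ← integral_const_mul,
    ← integral_sub (hint _ _) (hint _ _)]
  exact integral_congr_ae h

theorem inner_mul_eq_integral (f : Space d → ℝ) {ψ φ : L2 d}
    (h : φ =ᵐ[volume] fun x => (f x : ℂ) * ψ x) :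
    Integrable (fun x => f x * ‖ψ x‖ ^ 2) ∧ inner ℂ ψ φ = ((∫ x, f x * ‖ψ x‖ ^ 2 : ℝ) : ℂ) := by
  have h1 : (fun x => inner ℂ (ψ x) (φ x)) =ᵐ[volume] fun x => ((f x * ‖ψ x‖ ^ 2 : ℝ) : ℂ) := by
    filter_upwards [h] with x hx
    rw [hx, RCLike.inner_apply', mul_left_comm, RCLike.conj_mul]
    push_cast
    rfl
  refine ⟨?_, ?_⟩
  · exact ((L2.integrable_inner (𝕜 := ℂ) ψ φ).congr h1).re
  · rw [L2.inner_def, integral_congr_ae h1, integral_complex_ofReal]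

/-- The difference quotient `(ω - ω_a) / (1 - a)` on the Fourier side. -/
def symbolQuotient (ω : Space d → ℝ) (a : ℝ) (ξ : Space d) : ℝ :=
  (symbol ω ξ - symbol ω (a • ξ)) / (1 - a)

/-- The pointwise bound 0 ≤ (ω - ω_a)/(1 - a) ≤ cω makes the norm estimate uniform in `a`. -/
theorem exists_symbolQuotient_bound (hωm : Measurable ω) (hreg : KineticRegular ω) :
    ∃ c : ℝ, 0 < c ∧ ∀ a ∈ Ioo (1 / 2 : ℝ) 1, ∀ g : (mulOp (symbol ω)).domain,
      ∃ G : L2 d, (G =ᵐ[volume] fun ξ => (symbolQuotient ω a ξ : ℂ) * (g : L2 d) ξ) ∧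
        ‖G‖ ≤ c * ‖mulOp (symbol ω) g‖ := by
  obtain ⟨c, hc, h⟩ := hreg.exists_scaling_bound
  refine ⟨c, hc, fun a ha g => ?_⟩
  have h1a : 0 < 1 - a := by linarith [ha.2]
  have hbound : ∀ᵐ ξ : Space d, ‖(symbolQuotient ω a ξ : ℂ) * (g : L2 d) ξ‖ ≤
      c * ‖mulOp (symbol ω) g ξ‖ := by
    filter_upwards [ae_symbol h, coeFn_mulOp (symbol ω) g] with ξ hξ hg
    rw [hg, norm_mul, norm_mul, ← mul_assoc, Complex.norm_real, Complex.norm_real]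
    refine mul_le_mul_of_nonneg_right ?_ (norm_nonneg _)
    have h2 := hξ.2.1 a ⟨by linarith [ha.1], ha.2⟩
    have h3 := hξ.2.2 a ⟨ha.1.le, ha.2⟩
    rw [symbolQuotient, symbol_smul, symbol]
    rw [Real.norm_of_nonneg (div_nonneg (by linarith) h1a.le), Real.norm_of_nonneg hξ.1,
      div_le_iff₀ h1a]
    linarith
  have hsm : Measurable (symbolQuotient ω a) :=
    ((measurable_symbol hωm).sub ((measurable_symbol hωm).comp (measurable_const_smul a))).div_const
      _
  have hmeas : AEStronglyMeasurable
      (fun ξ => (symbolQuotient ω a ξ : ℂ) * (g : L2 d) ξ) volume :=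
    (Complex.measurable_ofReal.comp hsm).aestronglyMeasurable.mul
      (Lp.aestronglyMeasurable _)
  have hmem : MemLp (fun ξ => (symbolQuotient ω a ξ : ℂ) * (g : L2 d) ξ) 2 volume :=
    (Lp.memLp (mulOp (symbol ω) g)).of_le_mul hmeas hbound
  refine ⟨hmem.toLp _, hmem.coeFn_toLp, ?_⟩
  refine Lp.norm_le_mul_norm_of_ae_le_mul ?_
  filter_upwards [hbound, hmem.coeFn_toLp] with ξ h1 h2
  rwa [h2]

/-- The virial identity at a finite dilation parameter, for eigenfunctions. -/
theorem inner_symbolQuotient_eq {E : ℝ} (ψ : (kinetic ω).domain)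
    (hψV : (ψ : L2 d) ∈ (mulOp V).domain)
    (heig : kinetic ω ψ + mulOp V ⟨ψ, hψV⟩ = (E : ℂ) • (ψ : L2 d)) {a : ℝ} (ha0 : a ≠ 0)
    (ha1 : a ≠ 1) {G K : L2 d}
    (hG : G =ᵐ[volume] fun ξ => (symbolQuotient ω a ξ : ℂ) * fourierL2 d ψ ξ)
    (hK : K =ᵐ[volume] fun x => (((V x - V (a • x)) / (1 - a) : ℝ) : ℂ) * (ψ : L2 d) x) :
    inner ℂ G (dilation a (fourierL2 d ψ)) = inner ℂ (dilation a (ψ : L2 d)) K := by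
  set g : (mulOp (symbol ω)).domain := ⟨fourierL2 d ψ, mem_kinetic_domain.1 ψ.2⟩ with hg
  set v : L2 d := mulOp V ⟨ψ, hψV⟩ with hv
  have hT : kinetic ω ψ = (E : ℂ) • (ψ : L2 d) - v := eq_sub_of_add_eq heig
  have h1a : (1 - a : ℂ) ≠ 0 := by
    have : (1 - a : ℝ) ≠ 0 := sub_ne_zero.2 ha1.symm
    exact_mod_cast this
  -- In the difference of these two identities the contributions of E cancel, since E is real.
  have e1 := inner_dilation_eq a ha0 (ψ : L2 d) (kinetic ω ψ)
  have e2 := inner_dilation_eq a ha0 (kinetic ω ψ) (ψ : L2 d)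
  rw [fourier_kinetic, hT] at e1 e2
  rw [inner_sub_right, inner_smul_right] at e1
  rw [map_sub, map_smul, inner_sub_left, inner_smul_left, Complex.conj_ofReal] at e2
  have e3 : inner ℂ (mulOp (symbol ω) g) (dilation a (g : L2 d)) -
      inner ℂ (g : L2 d) (dilation a (mulOp (symbol ω) g)) =
      (1 - a : ℂ) * inner ℂ G (dilation a (g : L2 d)) := by
    refine inner_sub_inner_eq _ ?_
    filter_upwards [coeFn_mulOp (symbol ω) g, ae_comp_smul (coeFn_mulOp (symbol ω) g) ha0, hG,
      coeFn_dilation ha0 (g : L2 d), coeFn_dilation ha0 (mulOp (symbol ω) g)] with ξ h1 h2 h3 h4 h5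
    rw [h1, h3, h4, h5, h2, symbolQuotient]
    simp only [map_mul, Complex.conj_ofReal]
    push_cast
    field_simp
    ring
  have e4 : inner ℂ (dilation a (ψ : L2 d)) v - inner ℂ (dilation a v) (ψ : L2 d) =
      (1 - a : ℂ) * inner ℂ (dilation a (ψ : L2 d)) K := by
    refine inner_sub_inner_eq _ ?_
    filter_upwards [coeFn_mulOp V ⟨ψ, hψV⟩, ae_comp_smul (coeFn_mulOp V ⟨ψ, hψV⟩) ha0, hK,
      coeFn_dilation ha0 (ψ : L2 d), coeFn_dilation ha0 v] with x h1 h2 h3 h4 h5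
    rw [h3, h4, h5, hv, h1, h2]
    simp only [map_mul, Complex.conj_ofReal]
    push_cast
    field_simp
  refine mul_left_cancel₀ h1a ?_
  rw [← e4, ← e3]
  linear_combination e1 - e2

/-- The virial inequality `ℓ (E ‖ψ‖² - ⟨ψ, Vψ⟩) ≤ ⟨ψ, Wψ⟩` for eigenfunctions. -/
theorem virial_le (hωm : Measurable ω) (hreg : KineticRegular ω) {ℓ : ℝ}
    (hℓ : ScalingDerivLimit ω ℓ) (hvir : IsVirialLimit ω V W) {E : ℝ}
    (ψ : (kinetic ω).domain)
    (hψV : (ψ : L2 d) ∈ (mulOp V).domain)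
    (heig : kinetic ω ψ + mulOp V ⟨ψ, hψV⟩ = (E : ℂ) • (ψ : L2 d)) :
    ℓ * (E * ‖(ψ : L2 d)‖ ^ 2 - ∫ x, V x * ‖(ψ : L2 d) x‖ ^ 2) ≤
      ∫ x, W x * ‖(ψ : L2 d) x‖ ^ 2 := by
  obtain ⟨c, hc, hG⟩ := exists_symbolQuotient_bound hωm hreg
  set g : (mulOp (symbol ω)).domain := ⟨fourierL2 d ψ, mem_kinetic_domain.1 ψ.2⟩ with hg
  set w : L2 d := mulOp W ⟨ψ, hvir.1 ψ.2⟩ with hw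
  obtain ⟨hKmem, hKlim⟩ := hvir.2 ψ ψ.2
  -- A sequence is extracted because Banach–Steinhaus, used for the weak limit, needs a pointwise
  -- bounded family.
  obtain ⟨a, ha, hpa⟩ := exists_seq_forall_of_frequently
    (Eventually.and hKmem (Ioo_mem_nhdsLT (show (1 / 2 : ℝ) < 1 by norm_num))).frequently
  set K : ℕ → L2 d := fun n => (hpa n).1.toLp _ with hKdef
  have hK : ∀ n, K n =ᵐ[volume]
      fun x => (((V x - V (a n • x)) / (1 - a n) : ℝ) : ℂ) * (ψ : L2 d) x :=
    fun n => (hpa n).1.coeFn_toLp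
  choose G hGae hGnorm using fun n => hG (a n) (hpa n).2 g
  have hweak : ∀ φ, Tendsto (fun n => inner ℂ φ (K n)) atTop (𝓝 (inner ℂ φ w)) := by
    intro φ
    have h1 := (hKlim φ).comp ha
    have h2 : inner ℂ φ w = ∫ x, (starRingEnd ℂ) (φ x) * ((W x : ℂ) * (ψ : L2 d) x) := by
      rw [inner_eq_integral]
      refine integral_congr_ae ?_
      filter_upwards [coeFn_mulOp W ⟨ψ, hvir.1 ψ.2⟩] with x hx
      rw [hw, hx]
    rw [h2]
    refine h1.congr fun n => ?_
    rw [inner_eq_integral]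
    refine integral_congr_ae ?_
    filter_upwards [hK n] with x hx
    rw [hx]
  have h1 : Tendsto (fun n => inner ℂ (G n) (dilation (a n) (g : L2 d))) atTop
      (𝓝 (inner ℂ (ψ : L2 d) w)) := by
    refine (tendsto_inner_of_weak_of_strong hweak ((tendsto_dilation (ψ : L2 d)).comp ha)).congr
      fun n => ?_
    exact (inner_symbolQuotient_eq ψ hψV heig (by linarith [(hpa n).2.1]) (hpa n).2.2.ne
      (hGae n) (hK n)).symm
  -- `G n` stays bounded while the dilations converge strongly, so the dilation may be dropped in
  -- the limit.
  have h2 : Tendsto (fun n => inner ℂ (G n) (dilation (a n) (g : L2 d) - g)) atTop (𝓝 0) := by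
    have h3 : Tendsto (fun n => c * ‖mulOp (symbol ω) g‖ * ‖dilation (a n) (g : L2 d) - g‖)
        atTop (𝓝 0) := by
      simpa using (tendsto_iff_norm_sub_tendsto_zero.1
        ((tendsto_dilation (g : L2 d)).comp ha)).const_mul (c * ‖mulOp (symbol ω) g‖)
    refine squeeze_zero_norm (fun n => (norm_inner_le_norm _ _).trans ?_) h3
    exact mul_le_mul_of_nonneg_right (hGnorm n) (norm_nonneg _)
  have h3 : Tendsto (fun n => inner ℂ (g : L2 d) (G n)) atTop (𝓝 (inner ℂ w (ψ : L2 d))) := by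
    have h4 := ((continuous_star.tendsto _).comp (h1.sub h2))
    simpa only [Function.comp_def, ← inner_sub_right, sub_sub_cancel, sub_zero,
      RCLike.star_def, inner_conj_symm] using h4
  obtain ⟨hMint, hMeq⟩ := inner_mul_eq_integral (symbol ω) (coeFn_mulOp (symbol ω) g)
  set m : ℝ := ∫ ξ, symbol ω ξ * ‖(g : L2 d) ξ‖ ^ 2 with hm
  obtain ⟨hWint, hWeq⟩ := inner_mul_eq_integral W (coeFn_mulOp W ⟨ψ, hvir.1 ψ.2⟩)
  obtain ⟨hVint, hVeq⟩ := inner_mul_eq_integral V (coeFn_mulOp V ⟨ψ, hψV⟩)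
  -- The eigenvalue equation expresses the kinetic energy ⟨ψ, Tψ⟩ through E and V.
  have hmval : m = E * ‖(ψ : L2 d)‖ ^ 2 - ∫ x, V x * ‖(ψ : L2 d) x‖ ^ 2 := by
    rw [show mulOp (symbol ω) g = fourierL2 d (kinetic ω ψ) from (fourier_kinetic ψ).symm,
      LinearIsometryEquiv.inner_map_map, eq_sub_of_add_eq heig, inner_sub_right,
      inner_smul_right, inner_self_eq_norm_sq_to_K, hVeq] at hMeq
    have h5 : ((E * ‖(ψ : L2 d)‖ ^ 2 - ∫ x, V x * ‖(ψ : L2 d) x‖ ^ 2 : ℝ) : ℂ) = (m : ℂ) := by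
      rw [← hMeq]
      push_cast
      rfl
    exact_mod_cast h5.symm
  have hlow : ∀ n, (1 - scalingSup ω (a n)) / (1 - a n) * m ≤
      (inner ℂ (g : L2 d) (G n)).re := by
    intro n
    obtain ⟨hGint, hGeq⟩ := inner_mul_eq_integral (symbolQuotient ω (a n)) (hGae n)
    rw [hGeq, Complex.ofReal_re, hm, ← integral_const_mul]
    refine integral_mono_ae (hMint.const_mul _) hGint ?_
    filter_upwards [ae_symbol (ae_le_scalingSup_mul hreg hℓ ⟨(hpa n).2.1.le, (hpa n).2.2⟩)]
      with ξ hξ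
    have h1a : 0 < 1 - a n := by linarith [(hpa n).2.2]
    rw [← mul_assoc]
    refine mul_le_mul_of_nonneg_right ?_ (sq_nonneg _)
    rw [symbolQuotient, symbol_smul, symbol, div_mul_eq_mul_div]
    refine div_le_div_of_nonneg_right ?_ h1a.le
    linarith
  have hlim1 : Tendsto (fun n => (1 - scalingSup ω (a n)) / (1 - a n) * m) atTop (𝓝 (ℓ * m)) :=
    ((tendsto_one_sub_scalingSup_div hreg hℓ).comp ha).mul_const m
  have hlim2 := (Complex.continuous_re.tendsto _).comp h3
  have hfin := le_of_tendsto_of_tendsto' hlim1 hlim2 hlow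
  rw [← inner_conj_symm, hWeq, Complex.conj_ofReal, Complex.ofReal_re] at hfin
  rwa [← hmval]

theorem not_isEigenvalue_hamiltonian (hωm : Measurable ω) (hreg : KineticRegular ω) {ℓ : ℝ}
    (hℓ : ScalingDerivLimit ω ℓ) (hvir : IsVirialLimit ω V W)
    (hneg : ∀ ψ ∈ (kinetic ω).domain, ψ ≠ 0 →
      ∫ x, (V x + 1 / ℓ * W x) * ‖ψ x‖ ^ 2 < 0) {E : ℝ} (hE : 0 < E) :
    ¬ IsEigenvalue (hamiltonian ω V) (E : ℂ) := by
  rintro ⟨ψ, hψ0, heig⟩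
  have hψT : (ψ : L2 d) ∈ (kinetic ω).domain := ψ.2.1
  have hψV : (ψ : L2 d) ∈ (mulOp V).domain := ψ.2.2
  have h1 := virial_le hωm hreg hℓ hvir ⟨ψ, hψT⟩ hψV heig
  have h2 := hneg ψ hψT hψ0
  obtain ⟨hWint, -⟩ := inner_mul_eq_integral W (coeFn_mulOp W ⟨ψ, hvir.1 hψT⟩)
  obtain ⟨hVint, -⟩ := inner_mul_eq_integral V (coeFn_mulOp V ⟨ψ, hψV⟩)
  have hsplit : ∫ x, (V x + 1 / ℓ * W x) * ‖(ψ : L2 d) x‖ ^ 2 =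
      (∫ x, V x * ‖(ψ : L2 d) x‖ ^ 2) + 1 / ℓ * ∫ x, W x * ‖(ψ : L2 d) x‖ ^ 2 := by
    rw [← integral_const_mul, ← integral_add hVint (hWint.const_mul _)]
    refine integral_congr_ae (Eventually.of_forall fun x => ?_)
    simp only
    ring
  have hℓ0 := hℓ.2.2.2
  have hn : 0 < ‖(ψ : L2 d)‖ ^ 2 := by positivity
  have h3 : E * ‖(ψ : L2 d)‖ ^ 2 - ∫ x, V x * ‖(ψ : L2 d) x‖ ^ 2 ≤
      1 / ℓ * ∫ x, W x * ‖(ψ : L2 d) x‖ ^ 2 := by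
    rw [one_div, ← div_eq_inv_mul, le_div_iff₀ hℓ0, mul_comm]
    exact h1
  have h4 : 0 < E * ‖(ψ : L2 d)‖ ^ 2 := by positivity
  linarith

end

/-! ### Orthonormal sequences and Fredholm operators in Hilbert space. -/

section

section Hilbert

variable {H : Type*} [NormedAddCommGroup H] [InnerProductSpace ℂ H]

theorem tendsto_inner_orthonormal {u : ℕ → H} (hu : Orthonormal ℂ u) (φ : H) :
    Tendsto (fun n => inner ℂ (u n) φ) atTop (𝓝 0) := by
  have h := (hu.inner_products_summable φ).tendsto_atTop_zero
  rw [tendsto_zero_iff_norm_tendsto_zero]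
  have h2 := (Real.continuous_sqrt.tendsto 0).comp h
  simpa [Function.comp_def, Real.sqrt_sq (norm_nonneg _)] using h2

/-- Successive terms are orthogonal, so a limit would be zero although every term has norm one. -/
theorem not_tendsto_orthonormal {u : ℕ → H} (hu : Orthonormal ℂ u) (x : H) :
    ¬ Tendsto u atTop (𝓝 x) := by
  intro h
  have h1 : Tendsto (fun n => inner ℂ (u (n + 1)) (u n)) atTop (𝓝 (inner ℂ x x)) :=
    ((tendsto_add_atTop_iff_nat 1).2 h).inner h
  have h2 : (fun n => inner ℂ (u (n + 1)) (u n)) = fun _ => (0 : ℂ) := by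
    funext n
    exact hu.2 (by omega)
  rw [h2] at h1
  have h3 : x = 0 := inner_self_eq_zero.1 (tendsto_nhds_unique h1 tendsto_const_nhds)
  have h4 := h.norm
  simp only [hu.1, h3, norm_zero] at h4
  exact one_ne_zero (tendsto_nhds_unique tendsto_const_nhds h4)

variable [CompleteSpace H]

/-- `1 + K` is Fredholm when `K` is sequentially compact. -/
theorem isFredholm_one_add {K : H →L[ℂ] H}
    (hK : ∀ u : ℕ → H, (∃ R : ℝ, ∀ n, ‖u n‖ ≤ R) →
      ∃ (s : ℕ → ℕ) (φ : H), StrictMono s ∧ Tendsto (fun n => K (u (s n))) atTop (𝓝 φ)) :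
    (1 + K).IsFredholm := by
  have hTB : TotallyBounded (closure (K '' Metric.closedBall 0 1)) := by
    refine IsSeqCompact.totallyBounded fun y hy => ?_
    have h1 : ∀ n : ℕ, ∃ x ∈ Metric.closedBall (0 : H) 1, dist (y n) (K x) < 1 / (n + 1 : ℝ) := by
      intro n
      obtain ⟨-, ⟨x, hx, rfl⟩, h2⟩ := Metric.mem_closure_iff.1 (hy n) (1 / (n + 1 : ℝ))
        (by positivity)
      exact ⟨x, hx, h2⟩
    choose x hx hxy using h1
    obtain ⟨s, φ, hs, hφ⟩ := hK x ⟨1, fun n => mem_closedBall_zero_iff.1 (hx n)⟩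
    have hd : Tendsto (fun n => dist (K (x (s n))) (y (s n))) atTop (𝓝 0) := by
      refine squeeze_zero (fun _ => dist_nonneg) (fun n => ?_)
        (tendsto_one_div_add_atTop_nhds_zero_nat.comp hs.tendsto_atTop)
      rw [dist_comm]
      exact (hxy (s n)).le
    have hyφ := (tendsto_iff_of_dist hd).1 hφ
    exact ⟨φ, isClosed_closure.mem_of_tendsto hyφ (Eventually.of_forall fun n => hy _), s, hs,
      hyφ⟩
  obtain ⟨t, htf, ht⟩ := Metric.totallyBounded_iff.1 hTB (1 / 2) (by norm_num)
  -- Projecting `K` onto the span of a finite 1/2-net of the image of the unit ball gives a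
  -- finite-rank `F` with ‖K - F‖ ≤ 1/2. Then 1 + (K - F) is invertible, and its inverse inverts 1 +
  -- K modulo finite rank.
  let S : Submodule ℂ H := Submodule.span ℂ t
  have : FiniteDimensional ℂ S := FiniteDimensional.span_of_finite ℂ htf
  let F : H →L[ℂ] H := S.starProjection ∘L K
  have hR : ‖-(K - F)‖ ≤ 1 / 2 := by
    rw [norm_neg]
    refine ContinuousLinearMap.opNorm_le_of_unit_norm (by norm_num) fun x hx => ?_
    have hx1 : K x ∈ closure (K '' Metric.closedBall 0 1) :=
      subset_closure ⟨x, by simp [hx], rfl⟩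
    obtain ⟨y, hy, hxy⟩ := mem_iUnion₂.1 (ht hx1)
    have hyS : S.starProjection y = y :=
      Submodule.starProjection_eq_self_iff.2 (Submodule.subset_span hy)
    have h2 : (K - F) x = (K x - y) - S.starProjection (K x - y) := by
      simp only [F, sub_apply, ContinuousLinearMap.comp_apply, map_sub, hyS]
      abel
    rw [h2, ← Submodule.starProjection_orthogonal_val]
    refine (Submodule.norm_starProjection_apply_le _ _).trans ?_
    rw [Metric.mem_ball, dist_eq_norm] at hxy
    exact hxy.le
  obtain ⟨e, he⟩ : IsUnit (1 + (K - F)) := by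
    have := isUnit_one_sub_of_norm_lt_one (hR.trans_lt (by norm_num))
    rwa [sub_neg_eq_add] at this
  have hfin : (F : H →ₗ[ℂ] H).HasFiniteRange := by
    have hle : (F : H →ₗ[ℂ] H).range ≤ S := by
      rintro _ ⟨x, rfl⟩
      exact Submodule.starProjection_apply_mem S (K x)
    rw [LinearMap.HasFiniteRange, Submodule.fg_iff_finiteDimensional]
    exact Submodule.finiteDimensional_of_le hle
  refine ContinuousLinearMap.IsFredholm.of_isQuasiInverse (v := (↑e⁻¹ : H →L[ℂ] H)) ?_
  have h1 : (↑e⁻¹ : H →L[ℂ] H) ∘L (1 + K) = 1 + (↑e⁻¹ : H →L[ℂ] H) ∘L F := by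
    have h2 : (1 + K : H →L[ℂ] H) = ↑e + F := by rw [he]; abel
    rw [h2, ContinuousLinearMap.comp_add]
    congr 1
    exact e.inv_mul
  have h2 : (1 + K) ∘L (↑e⁻¹ : H →L[ℂ] H) = 1 + F ∘L (↑e⁻¹ : H →L[ℂ] H) := by
    have h2 : (1 + K : H →L[ℂ] H) = ↑e + F := by rw [he]; abel
    rw [h2, ContinuousLinearMap.add_comp]
    congr 1
    exact e.mul_inv
  constructor
  · refine LinearMap.FiniteRangeSetoid.equiv_iff_hasFiniteRange.2 ?_
    have h3 : ((↑e⁻¹ : H →L[ℂ] H) : H →ₗ[ℂ] H) ∘ₗ ((1 + K : H →L[ℂ] H) : H →ₗ[ℂ] H) -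
        LinearMap.id = ((↑e⁻¹ : H →L[ℂ] H) : H →ₗ[ℂ] H) ∘ₗ (F : H →ₗ[ℂ] H) := by
      ext x
      have := congr($h1 x)
      simp only [ContinuousLinearMap.comp_apply, add_apply,
        one_apply_eq_self] at this
      simp [this]
    rw [h3]
    exact hfin.comp_left _
  · refine LinearMap.FiniteRangeSetoid.equiv_iff_hasFiniteRange.2 ?_
    have h3 : ((1 + K : H →L[ℂ] H) : H →ₗ[ℂ] H) ∘ₗ ((↑e⁻¹ : H →L[ℂ] H) : H →ₗ[ℂ] H) -
        LinearMap.id = (F : H →ₗ[ℂ] H) ∘ₗ ((↑e⁻¹ : H →L[ℂ] H) : H →ₗ[ℂ] H) := by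
      ext x
      have := congr($h2 x)
      simp only [ContinuousLinearMap.comp_apply, add_apply,
        one_apply_eq_self] at this
      simp [this]
    rw [h3]
    exact hfin.comp_right _

/-- A closed operator with finite-dimensional kernel and closed range has no orthonormal sequence
of approximate null vectors. -/
theorem not_tendsto_zero_of_orthonormal {D : Submodule ℂ H} {S : D →ₗ[ℂ] H}
    (hclosed : IsClosed (((D.subtype.prod S).range : Submodule ℂ (H × H)) : Set (H × H)))
    (hker : FiniteDimensional ℂ S.ker) (hran : IsClosed (S.range : Set H))
    {u : ℕ → D} (hu : Orthonormal ℂ fun n => (u n : H)) :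
    ¬ Tendsto (fun n => S (u n)) atTop (𝓝 0) := by
  intro hlim
  let G : Submodule ℂ (H × H) := (D.subtype.prod S).range
  have : CompleteSpace G := hclosed.completeSpace_coe
  have : CompleteSpace S.range := hran.completeSpace_coe
  -- The open mapping theorem, applied to the map from the complete graph onto the closed range,
  -- supplies preimages `v n` of `S (u n)` with norms tending to zero.
  let f : G →L[ℂ] S.range :=
    ((ContinuousLinearMap.snd ℂ H H) ∘L G.subtypeL).codRestrict S.range (by
      rintro ⟨-, v, rfl⟩
      exact ⟨v, rfl⟩)
  have hf : Function.Surjective f := by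
    rintro ⟨-, v, rfl⟩
    exact ⟨⟨_, v, rfl⟩, rfl⟩
  obtain ⟨C, hC, hpre⟩ := f.exists_preimage_norm_le hf
  have hv : ∀ n, ∃ v : D, S v = S (u n) ∧ ‖(v : H)‖ ≤ C * ‖S (u n)‖ := by
    intro n
    obtain ⟨⟨-, v, rfl⟩, h1, h2⟩ := hpre ⟨S (u n), u n, rfl⟩
    exact ⟨v, congrArg Subtype.val h1, (norm_fst_le _).trans h2⟩
  choose v hvS hvn using hv
  have hv0 : Tendsto (fun n => (v n : H)) atTop (𝓝 0) := by
    refine squeeze_zero_norm hvn ?_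
    simpa using hlim.norm.const_mul C
  let N : Submodule ℂ H := S.ker.map D.subtype
  have hN : FiniteDimensional ℂ N := inferInstance
  have : ProperSpace N := FiniteDimensional.proper ℂ N
  -- The corrected vectors form a bounded sequence in the finite-dimensional kernel, so a
  -- subsequence converges; then so does that subsequence of `u`, against orthonormality.
  let w : ℕ → N := fun n => ⟨(u n : H) - v n, u n - v n, by simp [hvS], rfl⟩
  obtain ⟨R, hR⟩ := hv0.norm.bddAbove_range
  have hw : ∀ n, w n ∈ Metric.closedBall (0 : N) (1 + R) := by
    intro n
    rw [mem_closedBall_zero_iff]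
    change ‖(u n : H) - v n‖ ≤ 1 + R
    refine (norm_sub_le _ _).trans (add_le_add (hu.1 n).le (hR ⟨n, rfl⟩))
  obtain ⟨y, -, s, hs, hy⟩ := tendsto_subseq_of_bounded Metric.isBounded_closedBall hw
  have hy' : Tendsto (fun n => (w (s n) : H)) atTop (𝓝 (y : H)) :=
    (continuous_subtype_val.tendsto y).comp hy
  have hsum := hy'.add (hv0.comp hs.tendsto_atTop)
  refine not_tendsto_orthonormal (hu.comp s hs.injective) ((y : H) + 0) (hsum.congr fun n => ?_)
  simp [w]

end Hilbert

end

/-! ### Closedness of the operators. -/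

section

variable {d : ℕ} {ω V W : Space d → ℝ}

/-- Maximal multiplication operators are closed. -/
theorem mulOp_closed {f : Space d → ℝ} {u : ℕ → (mulOp f).domain} {x y : L2 d}
    (hx : Tendsto (fun n => (u n : L2 d)) atTop (𝓝 x))
    (hy : Tendsto (fun n => mulOp f (u n)) atTop (𝓝 y)) :
    ∃ h : x ∈ (mulOp f).domain, mulOp f ⟨x, h⟩ = y := by
  obtain ⟨s, hs, hsx⟩ := (tendstoInMeasure_of_tendsto_Lp hx).exists_seq_tendsto_ae
  obtain ⟨t, ht, hty⟩ :=
    (tendstoInMeasure_of_tendsto_Lp (hy.comp hs.tendsto_atTop)).exists_seq_tendsto_ae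
  have hae : y =ᵐ[volume] fun ξ => (f ξ : ℂ) * x ξ := by
    filter_upwards [hsx, hty, ae_all_iff.2 fun n => coeFn_mulOp f (u n)] with ξ h1 h2 h3
    simp only [Function.comp_apply, h3] at h2
    exact tendsto_nhds_unique h2 ((h1.comp ht.tendsto_atTop).const_mul _)
  have hmem : MemLp (fun ξ => (f ξ : ℂ) * x ξ) 2 volume := (memLp_congr_ae hae).1 (Lp.memLp y)
  refine ⟨hmem, Lp.ext ?_⟩
  filter_upwards [coeFn_mulOp f ⟨x, hmem⟩, hae] with ξ h1 h2
  rw [h1, h2]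

theorem kinetic_closed {u : ℕ → (kinetic ω).domain} {x y : L2 d}
    (hx : Tendsto (fun n => (u n : L2 d)) atTop (𝓝 x))
    (hy : Tendsto (fun n => kinetic ω (u n)) atTop (𝓝 y)) :
    ∃ h : x ∈ (kinetic ω).domain, kinetic ω ⟨x, h⟩ = y := by
  have hx' := ((fourierL2 d).continuous.tendsto x).comp hx
  have hy' := ((fourierL2 d).continuous.tendsto y).comp hy
  simp only [Function.comp_def, fourier_kinetic] at hx' hy'
  obtain ⟨h1, h2⟩ := mulOp_closed
    (u := fun n => ⟨fourierL2 d (u n), mem_kinetic_domain.1 (u n).2⟩) hx' hy'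
  refine ⟨mem_kinetic_domain.2 h1, (fourierL2 d).injective ?_⟩
  rw [fourier_kinetic]
  exact h2

theorem inner_mulOp_left {f : Space d → ℝ} (u v : (mulOp f).domain) :
    inner ℂ (mulOp f u) (v : L2 d) = inner ℂ (u : L2 d) (mulOp f v) := by
  rw [inner_eq_integral, inner_eq_integral]
  refine integral_congr_ae ?_
  filter_upwards [coeFn_mulOp f u, coeFn_mulOp f v] with x h1 h2
  rw [h1, h2, map_mul, Complex.conj_ofReal]
  ring

/-- Strong limits of a multiplication operator along an orthonormal sequence vanish. -/
theorem eq_zero_of_tendsto_mulOp_orthonormal {f : Space d → ℝ} (hf : Measurable f)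
    {u : ℕ → (mulOp f).domain} (hu : Orthonormal ℂ fun n => (u n : L2 d)) {χ : L2 d}
    (hχ : Tendsto (fun n => mulOp f (u n)) atTop (𝓝 χ)) : χ = 0 := by
  -- Cutting χ off to {|f| ≤ k} puts it in the domain, so `f` can be moved onto it by symmetry; weak
  -- convergence of `u` to zero then shows that the cut-off part is orthogonal to itself.
  have key : ∀ k : ℕ, ∀ᵐ x : Space d, |f x| ≤ k → χ x = 0 := by
    intro k
    set B : Set (Space d) := {x | |f x| ≤ k} with hB
    have hBm : MeasurableSet B := measurableSet_le hf.abs measurable_const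
    have hmem : MemLp (B.indicator χ) 2 volume := (Lp.memLp χ).indicator hBm
    set y : L2 d := hmem.toLp _ with hy
    have hyB : y =ᵐ[volume] B.indicator χ := hmem.coeFn_toLp
    have hydom : y ∈ (mulOp f).domain := by
      refine (Lp.memLp y).of_le_mul (c := k) ?_ ?_
      · exact (Complex.measurable_ofReal.comp hf).aestronglyMeasurable.mul
          (Lp.aestronglyMeasurable _)
      · filter_upwards [hyB] with x hx
        rw [hx, norm_mul, Complex.norm_real, Real.norm_eq_abs]
        by_cases hxB : x ∈ B
        · exact mul_le_mul_of_nonneg_right hxB (norm_nonneg _)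
        · simp [indicator_of_notMem hxB]
    have h1 : Tendsto (fun n => inner ℂ (mulOp f (u n)) y) atTop (𝓝 (inner ℂ χ y)) :=
      hχ.inner tendsto_const_nhds
    have h2 : Tendsto (fun n => inner ℂ (mulOp f (u n)) y) atTop (𝓝 0) :=
      (tendsto_inner_orthonormal hu (mulOp f ⟨y, hydom⟩)).congr fun n =>
        (inner_mulOp_left (u n) ⟨y, hydom⟩).symm
    have h3 : inner ℂ χ y = 0 := tendsto_nhds_unique h1 h2
    have h4 : inner ℂ y y = inner ℂ χ y := by
      rw [inner_eq_integral, inner_eq_integral]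
      refine integral_congr_ae ?_
      filter_upwards [hyB] with x hx
      rw [hx]
      by_cases hxB : x ∈ B
      · simp [indicator_of_mem hxB]
      · simp [indicator_of_notMem hxB]
    have h5 : y = 0 := inner_self_eq_zero.1 (h4.trans h3)
    filter_upwards [hyB, Lp.coeFn_zero ℂ 2 (volume : Measure (Space d))] with x hx h0 hxB
    rw [h5, h0, indicator_of_mem (show x ∈ B from hxB)] at hx
    exact hx.symm
  refine Lp.ext ?_
  filter_upwards [ae_all_iff.2 key, Lp.coeFn_zero ℂ 2 (volume : Measure (Space d))] with x hx h0
  obtain ⟨k, hk⟩ := exists_nat_ge |f x|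
  rw [hx k hk, h0, Pi.zero_apply]

/-- The shifted Hamiltonian is closed when `V` has relative bound less than one. -/
theorem isClosed_graph_subScalar_hamiltonian (hrel : RelBoundedLTOne (mulOp V) (kinetic ω))
    (z : ℂ) :
    IsClosed ((((hamiltonian ω V).domain.subtype.prod (subScalar (hamiltonian ω V) z)).range :
      Submodule ℂ (L2 d × L2 d)) : Set (L2 d × L2 d)) := by
  obtain ⟨hdom, r, C, hr0, hr1, hb⟩ := hrel
  -- Since r < 1, the term r‖Tu‖ coming from V is absorbed on the left: graph convergence for H
  -- controls that for T.
  have hbound : ∀ u : (kinetic ω).domain,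
      (1 - r) * ‖kinetic ω u‖ ≤ ‖kinetic ω u + mulOp V (Submodule.inclusion hdom u) -
        z • (u : L2 d)‖ + (|C| + ‖z‖) * ‖(u : L2 d)‖ := by
    intro u
    set S := kinetic ω u + mulOp V (Submodule.inclusion hdom u) - z • (u : L2 d) with hS
    have h1 : kinetic ω u = S - mulOp V (Submodule.inclusion hdom u) + z • (u : L2 d) := by
      rw [hS]
      abel
    have h2 : ‖kinetic ω u‖ ≤ ‖S‖ + ‖mulOp V (Submodule.inclusion hdom u)‖ + ‖z‖ * ‖(u : L2 d)‖ := by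
      rw [← norm_smul]
      conv_lhs => rw [h1]
      exact (norm_add_le _ _).trans (add_le_add_left (norm_sub_le _ _) _)
    have h3 := hb u
    have h4 : C * ‖(u : L2 d)‖ ≤ |C| * ‖(u : L2 d)‖ := by
      gcongr
      exact le_abs_self C
    linarith
  refine IsSeqClosed.isClosed fun p q hp hpq => ?_
  choose u hu using hp
  have hu1 : Tendsto (fun n => (u n : L2 d)) atTop (𝓝 q.1) :=
    ((continuous_fst.tendsto q).comp hpq).congr fun n => by rw [Function.comp_apply, ← hu n]; rfl
  have hu2 : Tendsto (fun n => subScalar (hamiltonian ω V) z (u n)) atTop (𝓝 q.2) :=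
    ((continuous_snd.tendsto q).comp hpq).congr fun n => by rw [Function.comp_apply, ← hu n]; rfl
  let t : ℕ → (kinetic ω).domain := fun n => ⟨u n, (u n).2.1⟩
  have hSt : ∀ n, subScalar (hamiltonian ω V) z (u n) =
      kinetic ω (t n) + mulOp V (Submodule.inclusion hdom (t n)) - z • (t n : L2 d) :=
    fun n => rfl
  have hcau : CauchySeq fun n => kinetic ω (t n) := by
    rw [Metric.cauchySeq_iff']
    intro ε hε
    have hr1' : 0 < 1 - r := by linarith
    set D := |C| + ‖z‖ with hD
    have hD0 : 0 ≤ D := by positivity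
    set δ := (1 - r) * ε / (2 * (1 + D)) with hδ
    have hδ0 : 0 < δ := by positivity
    obtain ⟨N2, hN2⟩ := Metric.cauchySeq_iff.1 hu1.cauchySeq δ hδ0
    obtain ⟨N3, hN3⟩ := Metric.cauchySeq_iff.1 hu2.cauchySeq δ hδ0
    refine ⟨max N2 N3, fun n hn => ?_⟩
    have e2 := hN2 n (le_of_max_le_left hn) (max N2 N3) (le_max_left _ _)
    have e3 := hN3 n (le_of_max_le_right hn) (max N2 N3) (le_max_right _ _)
    rw [dist_eq_norm] at e2 e3 ⊢
    have e4 := hbound (t n - t (max N2 N3))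
    have e5 : kinetic ω (t n - t (max N2 N3)) +
        mulOp V (Submodule.inclusion hdom (t n - t (max N2 N3))) -
        z • ((t n - t (max N2 N3) : (kinetic ω).domain) : L2 d) =
        subScalar (hamiltonian ω V) z (u n) - subScalar (hamiltonian ω V) z (u (max N2 N3)) := by
      rw [hSt, hSt, map_sub, LinearPMap.map_sub, LinearPMap.map_sub, Submodule.coe_sub, smul_sub]
      abel
    rw [e5, LinearPMap.map_sub, Submodule.coe_sub] at e4
    have e6 : D * ‖(t n : L2 d) - t (max N2 N3)‖ ≤ D * δ := by
      gcongr
    have e7 : (1 - r) * ‖kinetic ω (t n) - kinetic ω (t (max N2 N3))‖ < (1 - r) * ε := by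
      calc _ ≤ _ := e4
        _ < δ + D * δ := by linarith
        _ = (1 - r) * ε / 2 := by rw [hδ]; field_simp
        _ < (1 - r) * ε := by linarith [mul_pos hr1' hε]
    exact lt_of_mul_lt_mul_left e7 hr1'.le
  obtain ⟨w, hw⟩ := cauchySeq_tendsto_of_complete hcau
  obtain ⟨hqT, hTq⟩ := kinetic_closed (u := t) hu1 hw
  have hqV : q.1 ∈ (mulOp V).domain := hdom hqT
  have hVt : Tendsto (fun n => mulOp V (Submodule.inclusion hdom (t n))) atTop
      (𝓝 (mulOp V ⟨q.1, hqV⟩)) := by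
    rw [tendsto_iff_norm_sub_tendsto_zero]
    have e1 : Tendsto (fun n => r * ‖kinetic ω (t n) - w‖ + C * ‖(t n : L2 d) - q.1‖) atTop
        (𝓝 0) := by
      simpa using ((tendsto_iff_norm_sub_tendsto_zero.1 hw).const_mul r).add
        ((tendsto_iff_norm_sub_tendsto_zero.1 hu1).const_mul C)
    refine squeeze_zero (fun _ => norm_nonneg _) (fun n => ?_) e1
    have e2 := hb (t n - ⟨q.1, hqT⟩)
    rwa [map_sub, LinearPMap.map_sub, LinearPMap.map_sub, Submodule.coe_sub, hTq] at e2
  refine ⟨⟨q.1, hqT, hqV⟩, Prod.ext rfl ?_⟩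
  refine tendsto_nhds_unique (((hw.add hVt).sub (hu1.const_smul z)).congr fun n => (hSt n).symm)
    hu2 |> fun h => ?_
  rw [← h, ← hTq]
  rfl

end

/-! ### The essential spectrum. -/

section

variable {d : ℕ} {ω V W : Space d → ℝ}

theorem exists_dist_nonneg_real {z : ℂ} (hz : ¬ (0 ≤ z.re ∧ z.im = 0)) :
    ∃ δ : ℝ, 0 < δ ∧ ∀ t : ℝ, 0 ≤ t → δ ≤ ‖(t : ℂ) - z‖ := by
  by_cases him : z.im = 0
  · have hre : z.re < 0 := by
      by_contra h
      exact hz ⟨not_lt.1 h, him⟩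
    refine ⟨-z.re, by linarith, fun t ht => ?_⟩
    have h1 := (le_abs_self _).trans (Complex.abs_re_le_norm ((t : ℂ) - z))
    rw [Complex.sub_re, Complex.ofReal_re] at h1
    linarith
  · refine ⟨|z.im|, abs_pos.2 him, fun t _ => ?_⟩
    have h1 := Complex.abs_im_le_norm ((t : ℂ) - z)
    rwa [Complex.sub_im, Complex.ofReal_im, zero_sub, abs_neg] at h1

theorem coeFn_fourier_subScalar_kinetic (z : ℂ) (u : (kinetic ω).domain) :
    fourierL2 d (subScalar (kinetic ω) z u) =ᵐ[volume]
      fun ξ => ((symbol ω ξ : ℂ) - z) * fourierL2 d u ξ := by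
  have h1 : fourierL2 d (subScalar (kinetic ω) z u) =
      mulOp (symbol ω) ⟨fourierL2 d u, mem_kinetic_domain.1 u.2⟩ - z • fourierL2 d u := by
    rw [← fourier_kinetic, ← map_smul, ← map_sub]
    rfl
  rw [h1]
  filter_upwards [Lp.coeFn_sub (mulOp (symbol ω) ⟨fourierL2 d u, mem_kinetic_domain.1 u.2⟩)
    (z • fourierL2 d (u : L2 d)), Lp.coeFn_smul z (fourierL2 d (u : L2 d)),
    coeFn_mulOp (symbol ω) ⟨fourierL2 d u, mem_kinetic_domain.1 u.2⟩] with ξ h2 h3 h4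
  rw [h2, Pi.sub_apply, h3, h4, Pi.smul_apply, smul_eq_mul, sub_mul]

theorem le_norm_subScalar_kinetic {z : ℂ} {δ : ℝ} (hδ : 0 < δ)
    (h : ∀ᵐ ξ : Space d, δ ≤ ‖(symbol ω ξ : ℂ) - z‖) (u : (kinetic ω).domain) :
    ‖(u : L2 d)‖ ≤ δ⁻¹ * ‖subScalar (kinetic ω) z u‖ := by
  rw [← (fourierL2 d).norm_map (u : L2 d), ← (fourierL2 d).norm_map (subScalar (kinetic ω) z u)]
  refine Lp.norm_le_mul_norm_of_ae_le_mul ?_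
  filter_upwards [h, coeFn_fourier_subScalar_kinetic z u] with ξ h1 h2
  rw [h2, norm_mul, ← mul_assoc]
  refine le_mul_of_one_le_left (norm_nonneg _) ?_
  rwa [← div_eq_inv_mul, one_le_div hδ]

theorem surjective_subScalar_kinetic (hω : Measurable ω) {z : ℂ} {δ : ℝ} (hδ : 0 < δ)
    (h : ∀ᵐ ξ : Space d, δ ≤ ‖(symbol ω ξ : ℂ) - z‖) :
    Function.Surjective (subScalar (kinetic ω) z) := by
  intro f
  set g := fourierL2 d f with hg
  have hm : Measurable fun ξ => ((symbol ω ξ : ℂ) - z)⁻¹ :=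
    ((Complex.measurable_ofReal.comp (measurable_symbol hω)).sub_const z).inv
  have hmem : MemLp (fun ξ => ((symbol ω ξ : ℂ) - z)⁻¹ * g ξ) 2 volume := by
    refine (Lp.memLp g).of_le_mul (c := δ⁻¹)
      (hm.aestronglyMeasurable.mul (Lp.aestronglyMeasurable _)) ?_
    filter_upwards [h] with ξ h1
    rw [norm_mul, norm_inv]
    gcongr
  set y : L2 d := hmem.toLp _ with hy
  have hyae : y =ᵐ[volume] fun ξ => ((symbol ω ξ : ℂ) - z)⁻¹ * g ξ := hmem.coeFn_toLp
  have hyeq : ∀ᵐ ξ : Space d, ((symbol ω ξ : ℂ) - z) * y ξ = g ξ := by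
    filter_upwards [hyae, h] with ξ h1 h2
    have h3 : (symbol ω ξ : ℂ) - z ≠ 0 := norm_pos_iff.1 (hδ.trans_le h2)
    rw [h1, mul_inv_cancel_left₀ h3]
  have hydom : y ∈ (mulOp (symbol ω)).domain := by
    refine (memLp_congr_ae ?_).1 ((Lp.memLp g).add ((Lp.memLp y).const_mul z))
    filter_upwards [hyeq] with ξ h1
    rw [Pi.add_apply, ← h1]
    ring
  have hudom : (fourierL2 d).symm y ∈ (kinetic ω).domain := by
    rw [mem_kinetic_domain, LinearIsometryEquiv.apply_symm_apply]
    exact hydom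
  refine ⟨⟨(fourierL2 d).symm y, hudom⟩, (fourierL2 d).injective (Lp.ext ?_)⟩
  filter_upwards [coeFn_fourier_subScalar_kinetic z ⟨(fourierL2 d).symm y, hudom⟩, hyeq]
    with ξ h1 h2
  rw [h1]
  simp only [LinearIsometryEquiv.apply_symm_apply]
  exact h2

/-- Outside the range of the symbol the Hamiltonian is Fredholm. -/
theorem notMem_essSpectrum (hω : Measurable ω) (hreg : KineticRegular ω)
    (hrel : RelBoundedLTOne (mulOp V) (kinetic ω)) (hcomp : RelCompact (mulOp V) (kinetic ω))
    {z : ℂ} (hz : ¬ (0 ≤ z.re ∧ z.im = 0)) : z ∉ essSpectrum (hamiltonian ω V) := by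
  obtain ⟨δ, hδ, hdist⟩ := exists_dist_nonneg_real hz
  obtain ⟨c, -, hsc⟩ := hreg.exists_scaling_bound
  have hsep : ∀ᵐ ξ : Space d, δ ≤ ‖(symbol ω ξ : ℂ) - z‖ := by
    filter_upwards [ae_symbol hsc] with ξ hξ using hdist _ hξ.1
  obtain ⟨hdom, r, C, hr0, hr1, hb⟩ := hrel
  obtain ⟨hdom', hcpt⟩ := hcomp
  have hbd := le_norm_subScalar_kinetic hδ hsep
  have hinj : Function.Injective (subScalar (kinetic ω) z) := by
    rw [injective_iff_map_eq_zero]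
    intro u hu
    have h1 := hbd u
    rw [hu, norm_zero, mul_zero] at h1
    exact Subtype.ext (norm_le_zero_iff.1 h1)
  let e : (kinetic ω).domain ≃ₗ[ℂ] L2 d :=
    LinearEquiv.ofBijective (subScalar (kinetic ω) z)
      ⟨hinj, surjective_subScalar_kinetic hω hδ hsep⟩
  have he : ∀ f : L2 d, kinetic ω (e.symm f) - z • (e.symm f : L2 d) = f :=
    fun f => e.apply_symm_apply f
  have hsymm : ∀ f : L2 d, ‖(e.symm f : L2 d)‖ ≤ δ⁻¹ * ‖f‖ := by
    intro f
    have h1 := hbd (e.symm f)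
    rwa [show subScalar (kinetic ω) z (e.symm f) = f from he f] at h1
  have hkin : ∀ f : L2 d, ‖kinetic ω (e.symm f)‖ ≤ (1 + ‖z‖ * δ⁻¹) * ‖f‖ := by
    intro f
    rw [← sub_add_cancel (kinetic ω (e.symm f)) (z • (e.symm f : L2 d)), he f]
    refine (norm_add_le _ _).trans ?_
    rw [norm_smul, add_mul, one_mul, mul_assoc]
    gcongr
    exact hsymm f
  -- This is V(T - z)⁻¹; relative compactness of V is precisely its compactness, as (T - z)⁻¹ maps
  -- bounded sequences to ones bounded in graph norm.
  let K : L2 d →L[ℂ] L2 d :=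
    ((mulOp V).toFun ∘ₗ Submodule.inclusion hdom ∘ₗ e.symm.toLinearMap).mkContinuous
      (r * (1 + ‖z‖ * δ⁻¹) + |C| * δ⁻¹) (by
        intro f
        refine (hb (e.symm f)).trans ?_
        have h1 := mul_le_mul_of_nonneg_left (hkin f) hr0
        have h2 := mul_le_mul_of_nonneg_left (hsymm f) (abs_nonneg C)
        have h3 : C * ‖(e.symm f : L2 d)‖ ≤ |C| * ‖(e.symm f : L2 d)‖ := by
          gcongr
          exact le_abs_self C
        linarith)
  have hKapp : ∀ f, K f = mulOp V (Submodule.inclusion hdom (e.symm f)) := fun f => rfl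
  have hF : (1 + K).IsFredholm := by
    refine isFredholm_one_add fun u ⟨R, hR⟩ => ?_
    refine hcpt (fun n => e.symm (u n)) ⟨max (δ⁻¹ * R) ((1 + ‖z‖ * δ⁻¹) * R), fun n => ⟨?_, ?_⟩⟩
    · refine (hsymm _).trans (le_max_of_le_left ?_)
      gcongr
      exact hR n
    · refine (hkin _).trans (le_max_of_le_right ?_)
      gcongr
      exact hR n
  have hfac : ∀ u : (hamiltonian ω V).domain,
      subScalar (hamiltonian ω V) z u = (1 + K) (e ⟨u, u.2.1⟩) := by
    intro u
    have h1 : (1 + K) (e ⟨u, u.2.1⟩) = e ⟨u, u.2.1⟩ + K (e ⟨u, u.2.1⟩) := rfl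
    rw [h1, hKapp, LinearEquiv.symm_apply_apply]
    change kinetic ω ⟨u, u.2.1⟩ + mulOp V ⟨u, u.2.2⟩ - z • (u : L2 d) =
      (kinetic ω ⟨u, u.2.1⟩ - z • (u : L2 d)) + mulOp V ⟨u, u.2.2⟩
    abel
  have hrange : (subScalar (hamiltonian ω V) z).range = (1 + K).range := by
    ext y
    constructor
    · rintro ⟨u, rfl⟩
      exact ⟨e ⟨u, u.2.1⟩, (hfac u).symm⟩
    · rintro ⟨f, rfl⟩
      refine ⟨⟨e.symm f, (e.symm f).2, hdom (e.symm f).2⟩, ?_⟩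
      rw [hfac]
      exact congrArg (1 + K : L2 d →L[ℂ] L2 d) (e.apply_symm_apply f)
  have hkerK : FiniteDimensional ℂ (1 + K).ker := hF.finite_ker
  let j : (subScalar (hamiltonian ω V) z).ker →ₗ[ℂ] (1 + K).ker :=
    (e.toLinearMap ∘ₗ Submodule.inclusion (inf_le_left :
      (hamiltonian ω V).domain ≤ (kinetic ω).domain) ∘ₗ
      (subScalar (hamiltonian ω V) z).ker.subtype).codRestrict _ (by
        intro u
        have h1 := u.2
        rw [LinearMap.mem_ker, hfac] at h1
        exact h1)
  have hj : Function.Injective j := by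
    intro u v huv
    have h1 : e ⟨u, u.1.2.1⟩ = e ⟨v, v.1.2.1⟩ :=
      congrArg (fun t : (1 + K).ker => (t : L2 d)) huv
    have h2 : (u : L2 d) = v :=
      congrArg (fun t : (kinetic ω).domain => (t : L2 d)) (e.injective h1)
    exact Subtype.ext (Subtype.ext h2)
  rw [essSpectrum, mem_ofPred_eq, not_not]
  refine ⟨Module.Finite.of_injective j hj, ?_, ?_⟩
  · rw [hrange]
    exact hF.isClosed_range
  · rw [hrange]
    exact hF.finite_coker

/-- Every spectral window of the symbol supports a normalised function. -/
theorem exists_unit_supported (hω : Measurable ω) (hreg : KineticRegular ω) {ℓ : ℝ}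
    (hℓ : ScalingDerivLimit ω ℓ) {α β : ℝ} (hα : 0 < α) (hαβ : α < β) :
    ∃ g : L2 d, ‖g‖ = 1 ∧ ∀ᵐ ξ : Space d, g ξ ≠ 0 → symbol ω ξ ∈ Ioo α β := by
  set A : Set (Space d) := {ξ | symbol ω ξ ∈ Ioo α β} with hA
  have hAm : MeasurableSet A := measurable_symbol hω measurableSet_Ioo
  have hA0 : 0 < volume A := by
    -- The factor 2π in the symbol only rescales the measure of the level window.
    have h1 := Measure.addHaar_preimage_smul (volume : Measure (Space d))
      (show (2 * Real.pi) ≠ 0 by positivity) {ξ : Space d | ω ξ ∈ Ioo α β}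
    have h2 : volume A = _ := h1
    rw [h2]
    refine ENNReal.mul_pos ?_ (measure_symbol_mem_Ioo_ne_zero hreg hℓ hα hαβ)
    rw [ne_eq, ENNReal.ofReal_eq_zero, not_le]
    positivity
  obtain ⟨B, hBm, hBA, hB0, hBtop⟩ := Measure.exists_subset_measure_lt_top hAm hA0
  set f : L2 d := indicatorConstLp 2 hBm hBtop.ne (1 : ℂ) with hf
  have hfn : ‖f‖ ≠ 0 := by
    rw [hf, norm_indicatorConstLp (by norm_num) (by norm_num), norm_one, one_mul]
    have : 0 < volume.real B := ENNReal.toReal_pos hB0.ne' hBtop.ne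
    positivity
  refine ⟨((‖f‖⁻¹ : ℝ) : ℂ) • f, ?_, ?_⟩
  · rw [norm_smul, Complex.norm_real, norm_inv, norm_norm, inv_mul_cancel₀ hfn]
  · filter_upwards [Lp.coeFn_smul ((‖f‖⁻¹ : ℝ) : ℂ) f,
      (indicatorConstLp_coeFn : f =ᵐ[volume] _)] with ξ h1 h2 h3
    by_contra h4
    refine h3 ?_
    rw [h1, Pi.smul_apply, h2, indicator_of_notMem fun h => h4 (hBA h), smul_zero]

/-- A Weyl sequence for T at λ is also one for H along a subsequence, because V tends to zero on it;
this rules out a closed range together with a finite-dimensional kernel. -/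
theorem mem_essSpectrum (hω : Measurable ω) (hV : Measurable V) (hreg : KineticRegular ω) {ℓ : ℝ}
    (hℓ : ScalingDerivLimit ω ℓ)
    (hrel : RelBoundedLTOne (mulOp V) (kinetic ω)) (hcomp : RelCompact (mulOp V) (kinetic ω))
    {lam : ℝ} (hlam : 0 ≤ lam) : (lam : ℂ) ∈ essSpectrum (hamiltonian ω V) := by
  rintro ⟨hker, hran, -⟩
  -- The windows are disjoint, which yields orthogonality, and lie strictly above λ, so they consist
  -- of positive levels even when λ = 0.
  let I : ℕ → Set ℝ := fun n => Ioo (lam + 1 / (n + 1 + 1 : ℝ)) (lam + 1 / (n + 1 : ℝ))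
  have hex : ∀ n : ℕ, ∃ g : L2 d, ‖g‖ = 1 ∧ ∀ᵐ ξ : Space d, g ξ ≠ 0 → symbol ω ξ ∈ I n := by
    intro n
    refine exists_unit_supported hω hreg hℓ (by positivity) ?_
    have : 1 / (n + 1 + 1 : ℝ) < 1 / (n + 1 : ℝ) :=
      one_div_lt_one_div_of_lt (by positivity) (by linarith)
    linarith
  choose g hg1 hgsupp using hex
  have hbound : ∀ n, ∀ᵐ ξ : Space d, ‖((symbol ω ξ : ℂ) - lam) * g n ξ‖ ≤
      1 / (n + 1 : ℝ) * ‖g n ξ‖ := by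
    intro n
    filter_upwards [hgsupp n] with ξ hξ
    by_cases h0 : g n ξ = 0
    · simp [h0]
    · have h1 := hξ h0
      rw [norm_mul]
      refine mul_le_mul_of_nonneg_right ?_ (norm_nonneg _)
      rw [← Complex.ofReal_sub, Complex.norm_real, Real.norm_eq_abs, abs_le]
      have h2 : (0 : ℝ) < 1 / (n + 1 + 1 : ℝ) := by positivity
      have h3 : (0 : ℝ) < 1 / (n + 1 : ℝ) := by positivity
      constructor <;> linarith [h1.1, h1.2]
  have hgdom : ∀ n, g n ∈ (mulOp (symbol ω)).domain := by
    intro n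
    have hm : AEStronglyMeasurable (fun ξ => ((symbol ω ξ : ℂ) - lam) * g n ξ) volume :=
      ((Complex.measurable_ofReal.comp (measurable_symbol hω)).sub_const _).aestronglyMeasurable.mul
        (Lp.aestronglyMeasurable _)
    refine (memLp_congr_ae ?_).1 (((Lp.memLp (g n)).of_le_mul hm (hbound n)).add
      ((Lp.memLp (g n)).const_mul (lam : ℂ)))
    refine Eventually.of_forall fun ξ => ?_
    simp only [Pi.add_apply]
    ring
  have hortho : Orthonormal ℂ g := by
    refine ⟨hg1, fun m n hmn => ?_⟩
    refine (inner_eq_integral (g m) (g n)).trans (integral_eq_zero_of_ae ?_)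
    filter_upwards [hgsupp m, hgsupp n] with ξ h1 h2
    rw [Pi.zero_apply, mul_eq_zero, map_eq_zero]
    by_contra hcon
    push Not at hcon
    have hm := h1 hcon.1
    have hn := h2 hcon.2
    have hlt : ∀ i j : ℕ, i < j → symbol ω ξ ∈ I i → symbol ω ξ ∈ I j → False := by
      intro i j hij hi hj
      have h3 : (i + 1 : ℝ) ≤ j := by exact_mod_cast hij
      have h4 : 1 / (j + 1 : ℝ) ≤ 1 / (i + 1 + 1 : ℝ) :=
        one_div_le_one_div_of_le (by positivity) (by linarith)
      linarith [hi.1, hj.2]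
    rcases lt_or_gt_of_ne hmn with h | h
    · exact hlt m n h hm hn
    · exact hlt n m h hn hm
  let φ : ℕ → (kinetic ω).domain := fun n => ⟨(fourierL2 d).symm (g n), by
    rw [mem_kinetic_domain, LinearIsometryEquiv.apply_symm_apply]
    exact hgdom n⟩
  have hFφ : ∀ n, fourierL2 d (φ n) = g n := fun n => (fourierL2 d).apply_symm_apply _
  have hφortho : Orthonormal ℂ fun n => (φ n : L2 d) :=
    hortho.comp_linearIsometry (fourierL2 d).symm.toLinearIsometry
  have hTn : ∀ n, ‖subScalar (kinetic ω) lam (φ n)‖ ≤ 1 / (n + 1 : ℝ) := by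
    intro n
    rw [← (fourierL2 d).norm_map]
    have h1 : ‖fourierL2 d (subScalar (kinetic ω) lam (φ n))‖ ≤ 1 / (n + 1 : ℝ) * ‖g n‖ := by
      refine Lp.norm_le_mul_norm_of_ae_le_mul ?_
      filter_upwards [hbound n, coeFn_fourier_subScalar_kinetic (lam : ℂ) (φ n)] with ξ h1 h2
      rw [h2, hFφ]
      exact h1
    rwa [hg1, mul_one] at h1
  have hT0 : Tendsto (fun n => subScalar (kinetic ω) lam (φ n)) atTop (𝓝 0) :=
    squeeze_zero_norm hTn tendsto_one_div_add_atTop_nhds_zero_nat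
  obtain ⟨hdom, hcpt⟩ := hcomp
  -- Relative compactness gives a strong limit of V on a subsequence; orthonormality forces this
  -- limit to be zero.
  obtain ⟨s, χ, hs, hχ⟩ := hcpt φ ⟨1 + |lam|, fun n => by
    have h1 : ‖(φ n : L2 d)‖ = 1 := hφortho.1 n
    refine ⟨by rw [h1]; linarith [abs_nonneg lam], ?_⟩
    have h2 : kinetic ω (φ n) = subScalar (kinetic ω) lam (φ n) + (lam : ℂ) • (φ n : L2 d) :=
      (sub_add_cancel _ _).symm
    rw [h2]
    refine (norm_add_le _ _).trans (add_le_add ((hTn n).trans ?_) ?_)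
    · rw [div_le_one (by positivity)]
      linarith [(Nat.cast_nonneg n : (0 : ℝ) ≤ n)]
    · rw [norm_smul, h1, mul_one, Complex.norm_real, Real.norm_eq_abs]⟩
  have hsortho : Orthonormal ℂ fun n => (φ (s n) : L2 d) := hφortho.comp s hs.injective
  have hχ0 : χ = 0 := eq_zero_of_tendsto_mulOp_orthonormal hV
    (u := fun n => Submodule.inclusion hdom (φ (s n))) hsortho hχ
  rw [hχ0] at hχ
  refine not_tendsto_zero_of_orthonormal (isClosed_graph_subScalar_hamiltonian hrel (lam : ℂ))
    hker hran (u := fun n => ⟨φ (s n), (φ (s n)).2, hdom (φ (s n)).2⟩) hsortho ?_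
  have hsum := (hT0.comp hs.tendsto_atTop).add hχ
  rw [add_zero] at hsum
  refine hsum.congr fun n => ?_
  change (kinetic ω (φ (s n)) - (lam : ℂ) • (φ (s n) : L2 d)) +
    mulOp V (Submodule.inclusion hdom (φ (s n))) =
    kinetic ω (φ (s n)) + mulOp V (Submodule.inclusion hdom (φ (s n))) -
      (lam : ℂ) • (φ (s n) : L2 d)
  abel

theorem essSpectrum_hamiltonian (hω : Measurable ω) (hV : Measurable V) (hreg : KineticRegular ω)
    {ℓ : ℝ} (hℓ : ScalingDerivLimit ω ℓ)
    (hrel : RelBoundedLTOne (mulOp V) (kinetic ω)) (hcomp : RelCompact (mulOp V) (kinetic ω)) :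
    essSpectrum (hamiltonian ω V) = {z : ℂ | 0 ≤ z.re ∧ z.im = 0} := by
  ext z
  constructor
  · intro hz
    by_contra hcon
    exact notMem_essSpectrum hω hreg hrel hcomp hcon hz
  · rintro ⟨hre, him⟩
    have hz : z = ((z.re : ℝ) : ℂ) := Complex.ext rfl him
    rw [hz]
    exact mem_essSpectrum hω hV hreg hℓ hrel hcomp hre

end

end

end NonlocalSchrodinger

open NonlocalSchrodinger in
theorem theorem2p1 (d : ℕ) (ω V W : Space d → ℝ)
    (hωm : Measurable ω) (hVm : Measurable V) (hWm : Measurable W)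
    (hA1 : KineticRegular ω)
    (ℓ : ℝ) (hA2 : ScalingDerivLimit ω ℓ)
    (hA3 : RelBoundedLTOne (mulOp V) (kinetic ω))
    (hA4 : IsVirialLimit ω V W)
    (q : ℝ) (hq : q = 1 / ℓ)
    (hneg : ∀ ψ ∈ (kinetic ω).domain, ψ ≠ 0 →
      ∫ x, (V x + q * W x) * ‖ψ x‖ ^ 2 < 0) :
    (∀ E : ℝ, 0 < E → ¬ IsEigenvalue (hamiltonian ω V) (E : ℂ)) ∧
    (RelCompact (mulOp V) (kinetic ω) →
      essSpectrum (hamiltonian ω V) = {z : ℂ | 0 ≤ z.re ∧ z.im = 0} ∧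
      ∀ E : ℝ, 0 < E →
        ¬ ((E : ℂ) ∈ essSpectrum (hamiltonian ω V) ∧
          IsEigenvalue (hamiltonian ω V) (E : ℂ))) := by
  subst hq
  have hno : ∀ E : ℝ, 0 < E → ¬ IsEigenvalue (hamiltonian ω V) (E : ℂ) :=
    fun E hE => not_isEigenvalue_hamiltonian hωm hA1 hA2 hA4 hneg hE
  exact ⟨hno, fun hcomp => ⟨essSpectrum_hamiltonian hωm hVm hA1 hA2 hA3 hcomp,
    fun E hE h => hno E hE h.2⟩⟩
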